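/- Let $\mathfrak g$ be a finite-dimensional complex semisimple Lie algebra with Cartan subalgebra $\mathfrak h$, set of roots $\Pi$, Weyl group $\mathcal W$ (acting on $\mathfrak h$), and Killing form $\langle\cdot,\cdot\rangle$. Let $\mathfrak h_{\mathbb R}\subset\mathfrak h$ be the real subspace spanned by the roots, where a root $\alpha$ is identified with the element $t_\alpha\in\mathfrak h$ such that $\langle t_\alpha,y\rangle=\alpha(y)$ for all $y\in\mathfrak h$. For $H_0\in\mathfrak h$ let $\mathcal O(H_0)=\mathrm{Ad}(G)\cdot H_0\subset\mathfrak g$ be the adjoint orbit of $H_0$, where $G$ is a connected complex Lie group with Lie algebra $\mathfrak g$; that is, $\mathrm{Ad}(G)\subset GL(\mathfrak g)$ is the group generated by the maps $e^{\mathrm{ad}(z)}$, $z\in\mathfrak g$. Let $H_0\in\mathfrak h$ and let $H\in\mathfrak h_{\mathbb R}$ be regular, i.e. $\alpha(H)\neq 0$ for all $\alpha\in\Pi$. Then $\mathcal O(H_0)$ is an embedded complex submanifold of $\mathfrak g$, and for the function $$f_H:\mathcal O(H_0)\to\mathbb C,\qquad f_H(x)=\langle H,x\rangle,$$ a point $x\in\mathcal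 O(H_0)$ is a critical point of $f_H$ if and only if $x\in\mathcal O(H_0)\cap\mathfrak h$. Moreover $\mathcal O(H_0)\cap\mathfrak h=\mathcal W\cdot H_0$. -/

import Mathlib

open LieAlgebra

noncomputable section

section Submanifold

variable {E : Type*} [AddCommGroup E] [Module ℂ E] [TopologicalSpace E]

/-- `e` is a holomorphic parametrization of an open piece of the subset `M ⊆ E` (which carries the
subspace topology): a homeomorphism from an open subset of `ℂᵏ` onto an open subset of `M` which,
seen as a map into `E`, is complex differentiable with injective derivative. -/
def IsHolomorphicParametrization {M : Set E} {k : ℕ}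
    (e : OpenPartialHomeomorph (Fin k → ℂ) M) : Prop :=
  ∀ u ∈ e.source, ∃ φ' : (Fin k → ℂ) →L[ℂ] E,
    HasFDerivAt (fun v => (e v : E)) φ' u ∧ Function.Injective φ'

/-- `M` is an embedded complex submanifold of the complex vector space `E`. -/
def IsComplexSubmanifold (M : Set E) : Prop :=
  ∃ k : ℕ, ∀ x : M, ∃ e : OpenPartialHomeomorph (Fin k → ℂ) M,
    IsHolomorphicParametrization e ∧ x ∈ e.target

/-- `x` is a critical point of the function `f` on the complex submanifold `M`: in a holomorphic
parametrization around `x` (equivalently, in each of them) the differential of `f` at `x` exists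
and vanishes. -/
def IsCriticalPoint {M : Set E} (f : M → ℂ) (x : M) : Prop :=
  ∃ (k : ℕ) (e : OpenPartialHomeomorph (Fin k → ℂ) M),
    IsHolomorphicParametrization e ∧ x ∈ e.target ∧
      HasFDerivAt (fun v => f (e v)) (0 : (Fin k → ℂ) →L[ℂ] ℂ) (e.symm x)

end Submanifold

section Orbit

variable (L : Type*) [LieRing L] [LieAlgebra ℂ L] [TopologicalSpace L]

/-- The adjoint group of `L`: the subgroup of `GL(L)` generated by the exponentials
`exp (ad z) = ∑ (ad z)ⁿ / n!`. It is `Ad(G)` for every connected Lie group `G` with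
Lie algebra `L`. -/
def adjointGroup : Subgroup (L ≃ₗ[ℂ] L) :=
  Subgroup.closure {g | ∃ z : L, ∀ y : L,
    HasSum (fun n : ℕ => ((n.factorial : ℂ)⁻¹) • ((ad ℂ L z) ^ n) y) (g y)}

variable {L}

/-- The adjoint orbit `𝒪(H₀) = Ad(G) · H₀`. -/
def adjointOrbit (H₀ : L) : Set L := MulAction.orbit (adjointGroup L) H₀

/-- The height function `f_H(x) = ⟨H, x⟩` on the adjoint orbit of `H₀`, where `⟨·,·⟩` is the
Killing form. -/
def heightFunction (H H₀ : L) (x : adjointOrbit H₀) : ℂ := killingForm ℂ L H x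

end Orbit

section Cartan

variable {L : Type*} [LieRing L] [LieAlgebra ℂ L] [FiniteDimensional ℂ L] [IsSemisimple ℂ L]
  (𝔥 : LieSubalgebra ℂ L) [𝔥.IsCartanSubalgebra]

/-- The real subspace `𝔥_ℝ` of `𝔥` generated by the roots, each root `α` being identified with the
element `t_α` of `𝔥` such that `⟨t_α, y⟩ = α y` for all `y ∈ 𝔥`. -/
def realCartan : Submodule ℝ 𝔥 :=
  Submodule.span ℝ (Set.range fun α : 𝔥.root => (IsKilling.cartanEquivDual 𝔥).symm α.1.toLinear)

variable {𝔥} in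
/-- An element of `𝔥` is regular if no root vanishes on it. -/
def IsRegularElement (H : 𝔥) : Prop := ∀ α ∈ 𝔥.root, α H ≠ 0

variable {𝔥} in
/-- The orbit `𝒲 · H₀ ⊆ 𝔥` of the Weyl group. (Mathlib's Weyl group acts on the side of the
coroots, that is on `𝔥`, from the right; hence the opposite group.) -/
def weylOrbit (H₀ : 𝔥) : Set 𝔥 :=
  MulAction.orbit (IsKilling.rootSystem 𝔥).weylGroup.op H₀

end Cartan

end

/-! Critical points. The tangent space of the orbit at x is [x, 𝔤], and ⟨H, [x, y]⟩ = ⟨[H, x], y⟩,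
so by nondegeneracy x is critical iff [H, x] = 0 (`isCriticalPoint_heightFunction_iff`). For regular
H this centralizer is 𝔥 (`IsRegularElement.lie_eq_zero_iff`).

Submanifold. Since ad H₀ is semisimple, 𝔤 = [H₀, 𝔤] ⊕ ker ad H₀, and (v, c) ↦ exp(ad v)(H₀ + c) on
the two summands is locally invertible (`exists_parametrization_normed`). Near H₀ the orbit is the
slice c = 0: a conjugate of H₀ that commutes with H₀ and is close to it equals it, because the
eigenvalues of ad c would be small differences of eigenvalues of ad H₀
(`eventually_eq_zero_of_add_mem_adjointOrbit`). The adjoint group carries this chart to every other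
point.

Weyl orbit. Reflections come from the adjoint group (`exists_adjointGroup_apply_eq_reflection`).
Conversely, let H₁ ∈ 𝔥 be conjugate to H₀. A real linear form τ on ℂ orders the root values, and a
Weyl element moves H₁ into a closed chamber containing H₀. Let e be the wedge of the root vectors
with τ(α(H₀)) > c. A highest weight argument in the exterior power shows that the eigenvalue of H₁
on e is, under τ, at least that of H₀ (`sum_root_le_of_adjointGroup_apply_eq`). Summing over the
levels c, and exchanging H₀ and H₁, gives ∑ τ(α(H₀ - H₁))² ≤ 0, so H₀ = H₁ for a generic τ. -/

noncomputable section

set_option linter.unusedSectionVars false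

/-! ### Norms on finite-dimensional spaces -/

section FiniteDimensionalNorm

variable (E : Type*) [AddCommGroup E] [Module ℂ E] [FiniteDimensional ℂ E]
  [TopologicalSpace E] [IsTopologicalAddGroup E] [ContinuousSMul ℂ E] [T2Space E]

/-- A continuous linear equivalence of a finite-dimensional Hausdorff complex vector space with a
coordinate space. -/
def coordinates : E ≃L[ℂ] (Fin (Module.finrank ℂ E) → ℂ) :=
  ContinuousLinearEquiv.ofFinrankEq (by simp)

/-- A norm inducing the given topology of a finite-dimensional Hausdorff complex vector space. -/
@[reducible] def finiteDimensionalNorm : NormedAddCommGroup E :=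
  let N := NormedAddCommGroup.induced E _ (coordinates E) (coordinates E).injective
  { N with
    toMetricSpace := N.toMetricSpace.replaceTopology
      (coordinates E).toHomeomorph.isInducing.eq_induced }

/-- The norm `finiteDimensionalNorm` is compatible with the given module structure. -/
@[reducible] def finiteDimensionalNormedSpace :
    @NormedSpace ℂ E _ (finiteDimensionalNorm E).toSeminormedAddCommGroup :=
  let := finiteDimensionalNorm E
  { norm_smul_le := fun a x => by
      change ‖coordinates E (a • x)‖ ≤ ‖a‖ * ‖coordinates E x‖
      rw [map_smul, norm_smul] }

end FiniteDimensionalNorm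

/-! ### Exponentials and their action on multilinear forms -/

section Exponential

open NormedSpace

/-- The action of an endomorphism `A` on multilinear maps by
`(A • ω) u = ∑ᵢ ω (u₁, …, A uᵢ, …, uₖ)`. -/
def MultilinearMap.derivationAction {ι E : Type*} [Fintype ι] [DecidableEq ι]
    [AddCommGroup E] [Module ℂ E] (A : Module.End ℂ E) (ω : MultilinearMap ℂ (fun _ : ι => E) ℂ) :
    MultilinearMap ℂ (fun _ : ι => E) ℂ :=
  ∑ i, ω.compLinearMap (Function.update (fun _ => LinearMap.id) i A)

lemma MultilinearMap.derivationAction_apply {ι E : Type*} [Fintype ι] [DecidableEq ι]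
    [AddCommGroup E] [Module ℂ E] (A : Module.End ℂ E) (ω : MultilinearMap ℂ (fun _ : ι => E) ℂ)
    (u : ι → E) :
    derivationAction A ω u = ∑ i, ω (Function.update u i (A (u i))) := by
  simp only [derivationAction, sum_apply, MultilinearMap.compLinearMap_apply]
  refine Finset.sum_congr rfl fun i _ => congrArg ω (funext fun j => ?_)
  rcases eq_or_ne j i with rfl | h
  · simp
  · simp [h]

section Normed

variable {E : Type*} [NormedAddCommGroup E] [NormedSpace ℂ E] [FiniteDimensional ℂ E]

lemma hasSum_exp_apply (A : E →L[ℂ] E) (y : E) :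
    HasSum (fun n : ℕ => ((n.factorial : ℂ)⁻¹) • ((A : Module.End ℂ E) ^ n) y) (exp A y) := by
  have := FiniteDimensional.complete ℂ E
  have h := (exp_series_hasSum_exp' (𝕂 := ℂ) A).mapL (ContinuousLinearMap.apply ℂ E y)
  have hpow (n : ℕ) : (A ^ n) y = ((A : Module.End ℂ E) ^ n) y := by
    clear h
    induction n generalizing y with
    | zero => rfl
    | succ n ih => rw [pow_succ, pow_succ]; exact ih (A y)
  simp only [← hpow]
  exact h

lemma hasDerivAt_exp_smul_apply (A : E →L[ℂ] E) (y : E) (t : ℂ) :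
    HasDerivAt (fun s : ℂ => exp (s • A) y) (A (exp (t • A) y)) t := by
  have := FiniteDimensional.complete ℂ E
  have h := (hasDerivAt_exp_smul_const' (𝕂 := ℂ) A t).clm_apply (hasDerivAt_const t y)
  simpa using h

/-- The function s ↦ ω(exp(sA)u₁, …, exp(sA)uₖ) is entire and differentiating it replaces ω by A •
ω; this is its Taylor series at 0, evaluated at 1. -/
lemma MultilinearMap.hasSum_comp_exp_normed {ι : Type*} [Fintype ι] [DecidableEq ι]
    (A : E →L[ℂ] E) (ω : MultilinearMap ℂ (fun _ : ι => E) ℂ) (u : ι → E) :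
    HasSum (fun n : ℕ => ((n.factorial : ℂ)⁻¹) • ((derivationAction (A : Module.End ℂ E))^[n] ω) u)
      (ω fun i => exp A (u i)) := by
  have := FiniteDimensional.complete ℂ E
  have hcont (ω : MultilinearMap ℂ (fun _ : ι => E) ℂ) : Continuous ω := by
    let b := Module.finBasis ℂ E
    have h : (ω : (ι → E) → ℂ) = fun u => ∑ f : ι → Fin (Module.finrank ℂ E),
        (∏ i, b.equivFun (u i) (f i)) • ω fun i => b (f i) := by
      funext u
      conv_lhs => rw [show u = fun i => ∑ j, b.equivFun (u i) j • b j from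
        funext fun i => (b.sum_equivFun (u i)).symm]
      rw [MultilinearMap.map_sum]
      simp only [MultilinearMap.map_smul_univ]
    rw [h]
    have hb : Continuous b.equivFun := LinearMap.continuous_of_finiteDimensional
      (b.equivFun : E →ₗ[ℂ] Fin (Module.finrank ℂ E) → ℂ)
    fun_prop
  have hder (ω : MultilinearMap ℂ (fun _ : ι => E) ℂ) (t : ℂ) :
      HasDerivAt (fun s : ℂ => ω fun i => exp (s • A) (u i))
        (derivationAction (A : Module.End ℂ E) ω fun i => exp (t • A) (u i)) t := by
    let ω' : ContinuousMultilinearMap ℂ (fun _ : ι => E) ℂ := ⟨ω, hcont ω⟩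
    have h1 : HasDerivAt (fun s : ℂ => fun i => exp (s • A) (u i))
        (fun i => A (exp (t • A) (u i))) t :=
      hasDerivAt_pi.2 fun i => hasDerivAt_exp_smul_apply A (u i) t
    have h2 := (ω'.hasFDerivAt (fun i => exp (t • A) (u i))).comp_hasDerivAt t h1
    rw [ContinuousMultilinearMap.linearDeriv_apply] at h2
    rw [derivationAction_apply]
    exact h2
  have hiter (n : ℕ) : iteratedDeriv n (fun s : ℂ => ω fun i => exp (s • A) (u i)) =
      fun t => ((derivationAction (A : Module.End ℂ E))^[n] ω) fun i => exp (t • A) (u i) := by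
    induction n with
    | zero => simp
    | succ n ih =>
      rw [iteratedDeriv_succ, ih]
      funext t
      rw [(hder _ t).deriv, Function.iterate_succ_apply']
  have h := Complex.hasSum_taylorSeries_of_entire
    (f := fun s : ℂ => ω fun i => exp (s • A) (u i)) (fun t => (hder ω t).differentiableAt) 0 1
  simpa [hiter] using h

end Normed

variable {E : Type*} [AddCommGroup E] [Module ℂ E] [FiniteDimensional ℂ E]
  [TopologicalSpace E] [IsTopologicalAddGroup E] [ContinuousSMul ℂ E] [T2Space E]

/-- `g` is the exponential of the endomorphism `A`. -/
def IsExp (A : Module.End ℂ E) (g : E → E) : Prop :=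
  ∀ y : E, HasSum (fun n : ℕ => ((n.factorial : ℂ)⁻¹) • (A ^ n) y) (g y)

lemma exists_isExp_and_isExp_symm (A : Module.End ℂ E) :
    ∃ g : E ≃ₗ[ℂ] E, IsExp A g ∧ IsExp (-A) g.symm := by
  let := finiteDimensionalNorm E
  let := finiteDimensionalNormedSpace E
  have := FiniteDimensional.complete ℂ E
  let A' : E →L[ℂ] E := LinearMap.toContinuousLinearMap A
  have h1 : exp A' * exp (-A') = 1 := by
    rw [← exp_add_of_commute_of_mem_ball (𝕂 := ℂ) (Commute.neg_right (Commute.refl A'))] <;>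
      simp [expSeries_radius_eq_top]
  have h2 : exp (-A') * exp A' = 1 := by
    rw [← exp_add_of_commute_of_mem_ball (𝕂 := ℂ) (Commute.neg_left (Commute.refl A'))] <;>
      simp [expSeries_radius_eq_top]
  refine ⟨LinearEquiv.ofLinearMap (exp A' : E →L[ℂ] E) (exp (-A') : E →L[ℂ] E)
    (LinearMap.ext fun y => congr($h1 y)) (LinearMap.ext fun y => congr($h2 y)), fun y => ?_,
    fun y => ?_⟩
  · exact hasSum_exp_apply A' y
  · exact hasSum_exp_apply (-A') y

lemma exists_isExp (A : Module.End ℂ E) : ∃ g : E ≃ₗ[ℂ] E, IsExp A g :=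
  (exists_isExp_and_isExp_symm A).imp fun _ h => h.1

lemma IsExp.symm {A : Module.End ℂ E} {g : E ≃ₗ[ℂ] E} (hg : IsExp A g) : IsExp (-A) g.symm := by
  obtain ⟨k, hk, hk'⟩ := exists_isExp_and_isExp_symm A
  have : g = k := LinearEquiv.ext fun y => (hg y).unique (hk y)
  rwa [this]

lemma MultilinearMap.hasSum_comp_exp {ι : Type*} [Fintype ι] [DecidableEq ι]
    {A : Module.End ℂ E} {g : E → E} (hg : IsExp A g)
    (ω : MultilinearMap ℂ (fun _ : ι => E) ℂ) (u : ι → E) :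
    HasSum (fun n : ℕ => ((n.factorial : ℂ)⁻¹) • ((derivationAction A)^[n] ω) u)
      (ω fun i => g (u i)) := by
  let := finiteDimensionalNorm E
  let := finiteDimensionalNormedSpace E
  have h := MultilinearMap.hasSum_comp_exp_normed (LinearMap.toContinuousLinearMap A) ω u
  have hg' : g = fun y => exp (LinearMap.toContinuousLinearMap A) y :=
    funext fun y => (hg y).unique (hasSum_exp_apply (LinearMap.toContinuousLinearMap A) y)
  rw [hg']
  exact h

end Exponential

/-! ### Tangent vectors and slice charts -/

section Submanifold

open NormedSpace Filter Topology Module Asymptotics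

section Normed

variable {E : Type*} [NormedAddCommGroup E] [NormedSpace ℂ E] [FiniteDimensional ℂ E]

/-- The curve is differentiable only as a map into `E`. Injectivity of the derivative of the chart
bounds it below, so the curve read in the chart is O(t); then f ∘ γ varies by o(t). -/
lemma IsHolomorphicParametrization.apply_velocity_eq_zero_normed {M : Set E} {k : ℕ}
    {e : OpenPartialHomeomorph (Fin k → ℂ) M} (he : IsHolomorphicParametrization e) {x : M}
    (hx : x ∈ e.target) (f : E →ₗ[ℂ] ℂ)
    (hf : HasFDerivAt (fun v => f (e v)) (0 : (Fin k → ℂ) →L[ℂ] ℂ) (e.symm x))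
    {γ : ℂ → M} (hγ : γ 0 = x) {w : E} (hw : HasDerivAt (fun t => (γ t : E)) w 0) : f w = 0 := by
  subst hγ
  obtain ⟨φ', hφ, hinj⟩ := he (e.symm (γ 0)) (e.map_target hx)
  obtain ⟨C, -, hC⟩ := (φ' : (Fin k → ℂ) →ₗ[ℂ] E).exists_antilipschitzWith
    (LinearMap.ker_eq_bot.2 hinj)
  have hγc : ContinuousAt γ 0 := IsInducing.subtypeVal.continuousAt_iff.2 hw.continuousAt
  have hvc : Tendsto (fun t => e.symm (γ t)) (𝓝 0) (𝓝 (e.symm (γ 0))) :=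
    (e.continuousAt_symm hx).comp hγc
  have hback : ∀ᶠ t in 𝓝 (0 : ℂ), e (e.symm (γ t)) = γ t := by
    filter_upwards [hγc.eventually (e.open_target.mem_nhds hx)] with t ht using e.right_inv ht
  have hv : (fun t => e.symm (γ t) - e.symm (γ 0)) =O[𝓝 0] fun t : ℂ => t - 0 := by
    have h0 : (fun v => v - e.symm (γ 0)) =O[𝓝 (e.symm (γ 0))]
        fun v => φ' (v - e.symm (γ 0)) :=
      .of_bound C <| .of_forall fun v => by simpa using hC.le_mul_dist (v - e.symm (γ 0)) 0
    have h1 := (h0.trans (IsEquivalent.isBigO_symm (hφ.isLittleO.trans_isBigO h0))).comp_tendsto hvc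
    refine h1.trans ((hw.isBigO_sub).congr' ?_ .rfl)
    filter_upwards [hback] with t ht
    simp [ht, e.right_inv hx]
  have h0 : HasDerivAt (fun t => f (γ t : E)) 0 0 := by
    rw [hasDerivAt_iff_isLittleO]
    have h1 := (hf.isLittleO.comp_tendsto hvc).trans_isBigO hv
    refine h1.congr' ?_ .rfl
    filter_upwards [hback] with t ht
    simp [ht, e.right_inv hx]
  exact ((LinearMap.toContinuousLinearMap f).hasFDerivAt.comp_hasDerivAt 0 hw).unique h0

/-- Inverse function theorem for Ψ(v, c) = exp(a(ιv))(x + c), with ι onto the range of `a x` and c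
in its kernel. As the exponentials preserve `O`, the point Ψ(v, c) lies in `O` iff x + c does, which
by `hiso` forces c = 0. The last clause identifies the tangent directions, as needed for critical
points. -/
lemma exists_parametrization_normed (a : E →ₗ[ℂ] Module.End ℂ E) {x : E} {O : Set E} (hx : x ∈ O)
    (hanti : ∀ y, a y x = -a x y) (hdisj : ∀ y, a x (a x y) = 0 → a x y = 0)
    (hO : ∀ w y, exp (LinearMap.toContinuousLinearMap (a w)) y ∈ O ↔ y ∈ O)
    (hiso : ∀ᶠ c in 𝓝 (0 : E), a x c = 0 → x + c ∈ O → c = 0) :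
    ∃ e : OpenPartialHomeomorph (Fin (finrank ℂ (LinearMap.range (a x))) → ℂ) O,
      IsHolomorphicParametrization e ∧ ⟨x, hx⟩ ∈ e.target ∧
        ∃ φ' : (Fin (finrank ℂ (LinearMap.range (a x))) → ℂ) →L[ℂ] E,
          HasFDerivAt (fun v => (e v : E)) φ' (e.symm ⟨x, hx⟩) ∧ ∀ v, ∃ y, φ' v = a x y := by
  have := FiniteDimensional.complete ℂ E
  set k := finrank ℂ (LinearMap.range (a x)) with hk
  let ι₀ : (Fin k → ℂ) ≃ₗ[ℂ] LinearMap.range (a x) :=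
    LinearEquiv.ofFinrankEq _ _ (by simp [hk])
  let ι : (Fin k → ℂ) →L[ℂ] E :=
    LinearMap.toContinuousLinearMap ((LinearMap.range (a x)).subtype ∘ₗ ι₀.toLinearMap)
  have hι (v) : ∃ y, a x y = ι v := (ι₀ v).2
  have hι0 (v) (h : ι v = 0) : v = 0 := by
    have : ι₀ v = 0 := Subtype.ext h
    simpa using this
  let K := LinearMap.ker (a x)
  let a' : E →L[ℂ] E →L[ℂ] E :=
    LinearMap.toContinuousLinearMap (LinearMap.toContinuousLinearMap.toLinearMap ∘ₗ a)
  have ha' (w y) : a' w y = a w y := rfl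
  let Ψ : (Fin k → ℂ) × K → E := fun p => exp (a' (ι p.1)) (x + p.2)
  have hexp : ContDiff ℂ 1 (exp : (E →L[ℂ] E) → (E →L[ℂ] E)) :=
    contDiff_iff_contDiffAt.2 fun z => (exp_analytic (𝕂 := ℂ) z).contDiffAt
  have hΨ : ContDiff ℂ 1 Ψ :=
    (hexp.comp (a'.contDiff.comp (ι.contDiff.comp contDiff_fst))).clm_apply
      (contDiff_const.add (K.subtypeL.contDiff.comp contDiff_snd))
  let D : ((Fin k → ℂ) × K) →L[ℂ] E :=
    (a'.flip x).comp (ι.comp (.fst ℂ _ _)) + K.subtypeL.comp (.snd ℂ _ _)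
  have hDapp (p) : D p = a (ι p.1) x + p.2 := rfl
  have hD : HasFDerivAt Ψ D 0 := by
    have h1 : HasFDerivAt (exp : (E →L[ℂ] E) → (E →L[ℂ] E)) (1 : (E →L[ℂ] E) →L[ℂ] _)
        (a' (ι (0 : (Fin k → ℂ) × K).1)) := by
      simpa using hasFDerivAt_exp_zero (𝕂 := ℂ) (𝔸 := E →L[ℂ] E)
    have h2 : HasFDerivAt (fun p : (Fin k → ℂ) × K => a' (ι p.1))
        (a'.comp (ι.comp (.fst ℂ _ _))) 0 :=
      (a'.comp (ι.comp (.fst ℂ (Fin k → ℂ) K))).hasFDerivAt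
    have h3 : HasFDerivAt (fun p : (Fin k → ℂ) × K => x + (p.2 : E))
        (K.subtypeL.comp (.snd ℂ _ _)) 0 :=
      (K.subtypeL.comp (.snd ℂ (Fin k → ℂ) K)).hasFDerivAt.const_add x
    have h4 := (h1.comp 0 h2).clm_apply h3
    refine h4.congr_fderiv ?_
    ext p <;> simp [D]
  have hDinj : Function.Injective D := by
    rw [injective_iff_map_eq_zero]
    rintro ⟨v, c⟩ h
    obtain ⟨y, hy⟩ := hι v
    have hc : a x c = 0 := c.2
    have h : a (ι v) x + c = 0 := h
    -- The equation now reads a x (ιv) = c, and c is in the kernel; since ιv is in the range,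
    -- `hdisj` used twice kills both.
    rw [hanti] at h
    have h5 : a x (ι v) = c := by rw [neg_add_eq_zero] at h; exact h
    have h6 : a x (a x (ι v)) = 0 := by rw [h5, hc]
    have h7 := hdisj _ h6
    have h8 : ι v = 0 := by rw [← hy] at h7 ⊢; exact hdisj _ h7
    rw [h8, map_zero] at h5
    exact Prod.ext (hι0 v h8) (Subtype.ext h5.symm)
  have hdim : finrank ℂ ((Fin k → ℂ) × K) = finrank ℂ E := by
    rw [finrank_prod, ← LinearMap.finrank_range_add_finrank_ker (a x)]
    simp [hk, K]
  let D' : ((Fin k → ℂ) × K) ≃L[ℂ] E :=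
    (LinearEquiv.ofInjectiveOfFinrankEq (D : _ →ₗ[ℂ] E) hDinj hdim).toContinuousLinearEquiv
  have hD'D : (D' : ((Fin k → ℂ) × K) →L[ℂ] E) = D := ContinuousLinearMap.ext fun p => rfl
  have hD' : HasFDerivAt Ψ (D' : ((Fin k → ℂ) × K) →L[ℂ] E) 0 := hD'D ▸ hD
  let P₀ := hΨ.contDiffAt.toOpenPartialHomeomorph Ψ hD' one_ne_zero
  have hP₀ : (0 : (Fin k → ℂ) × K) ∈ P₀.source :=
    hΨ.contDiffAt.mem_toOpenPartialHomeomorph_source hD' one_ne_zero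
  -- A parametrization needs an injective derivative on its whole source, so the domain is shrunk to
  -- where the derivative of Ψ stays invertible and `hiso` applies.
  obtain ⟨U, hU, hUo, hU0⟩ : ∃ U : Set ((Fin k → ℂ) × K), (∀ p ∈ U,
      Function.Injective (fderiv ℂ Ψ p) ∧ (x + (p.2 : E) ∈ O → (p.2 : E) = 0)) ∧
      IsOpen U ∧ (0 : (Fin k → ℂ) × K) ∈ U := by
    rw [← eventually_nhds_iff]
    have h1 : ∀ᶠ p in 𝓝 (0 : (Fin k → ℂ) × K), fderiv ℂ Ψ p ∈
        Set.range ((↑) : (((Fin k → ℂ) × K) ≃L[ℂ] E) → _) :=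
      (hΨ.continuous_fderiv one_ne_zero).continuousAt.eventually
        (by rw [hD'.fderiv]; exact D'.nhds)
    have h2 : Tendsto (fun p : (Fin k → ℂ) × K => (p.2 : E)) (𝓝 0) (𝓝 0) := by
      have : Continuous (fun p : (Fin k → ℂ) × K => (p.2 : E)) := by fun_prop
      simpa using this.tendsto 0
    filter_upwards [h1, h2.eventually hiso] with p ⟨F, hF⟩ hp
    exact ⟨by rw [← hF]; exact F.injective, hp p.2.2⟩
  let P := P₀.restrOpen U hUo
  have hPsrc (p) (hp : p ∈ P.source) : p ∈ U := by
    rw [OpenPartialHomeomorph.restrOpen_source] at hp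
    exact hp.2
  have hP0 : (0 : (Fin k → ℂ) × K) ∈ P.source := by
    rw [OpenPartialHomeomorph.restrOpen_source]
    exact ⟨hP₀, hU0⟩
  have hPapp (p) : P p = Ψ p := rfl
  have hΨO (v) : Ψ (v, 0) ∈ O := by
    have := (hO (ι v) x).2 hx
    change exp (a' (ι v)) (x + ((0 : K) : E)) ∈ O
    rw [ZeroMemClass.coe_zero, add_zero]
    exact this
  have hsymm (y : E) (hy : y ∈ O) (hyt : y ∈ P.target) : P.symm y = ((P.symm y).1, 0) := by
    have h1 := P.map_target hyt
    have h2 : Ψ (P.symm y) ∈ O := by rw [← hPapp, P.right_inv hyt]; exact hy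
    exact Prod.ext rfl (Subtype.ext ((hU _ (hPsrc _ h1)).2 ((hO _ _).1 h2)))
  have hcont : Continuous fun v : Fin k → ℂ => (v, (0 : K)) := by fun_prop
  let e : OpenPartialHomeomorph (Fin k → ℂ) O :=
    { toFun := fun v => ⟨Ψ (v, 0), hΨO v⟩
      invFun := fun y => (P.symm y).1
      source := {v | (v, (0 : K)) ∈ P.source}
      target := {y | (y : E) ∈ P.target}
      map_source' := fun v hv => P.map_source hv
      map_target' := fun y hy => by
        have := P.map_target hy
        rw [hsymm y y.2 hy] at this
        exact this
      left_inv' := fun v hv => congrArg Prod.fst (P.left_inv hv)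
      right_inv' := fun y hy => Subtype.ext <| by
        have := P.right_inv hy
        rw [hsymm y y.2 hy] at this
        exact this
      open_source := P.open_source.preimage hcont
      open_target := P.open_target.preimage continuous_subtype_val
      continuousOn_toFun :=
        ((hΨ.continuous.comp hcont).subtype_mk fun v => hΨO v).continuousOn
      continuousOn_invFun := continuous_fst.comp_continuousOn
        (P.continuousOn_symm.comp continuous_subtype_val.continuousOn fun y hy => hy) }
  have heder (v) : HasFDerivAt (fun v => (e v : E))
      ((fderiv ℂ Ψ (v, 0)).comp (.inl ℂ _ _)) v :=
    HasFDerivAt.comp (g := Ψ) (f := fun v => (v, (0 : K))) v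
      (hΨ.differentiable one_ne_zero (v, 0)).hasFDerivAt
      (ContinuousLinearMap.inl ℂ (Fin k → ℂ) K).hasFDerivAt
  have hΨ0 : Ψ 0 = x := by simp [Ψ]
  have hxt : (⟨x, hx⟩ : O) ∈ e.target := by
    have := P.map_source hP0
    rw [hPapp, hΨ0] at this
    exact this
  have hex : e.symm ⟨x, hx⟩ = 0 := by
    have := P.left_inv hP0
    rw [hPapp, hΨ0] at this
    exact congrArg Prod.fst this
  -- At the origin the derivative is v ↦ a(ιv) x = a x (-ιv), whence the witness -ιv.
  refine ⟨e, fun v hv => ⟨_, heder v, ?_⟩, hxt, _, heder _, fun v => ⟨-ι v, ?_⟩⟩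
  · exact (hU _ (hPsrc _ hv)).1.comp (fun v w h => congrArg Prod.fst h)
  · rw [hex]
    have : fderiv ℂ Ψ ((0 : Fin k → ℂ), (0 : K)) = D := hD.fderiv
    rw [this, map_neg, ← hanti]
    simp [hDapp]

end Normed

variable {E : Type*} [AddCommGroup E] [Module ℂ E] [FiniteDimensional ℂ E]
  [TopologicalSpace E] [IsTopologicalAddGroup E] [ContinuousSMul ℂ E] [T2Space E]

lemma IsHolomorphicParametrization.apply_eq_zero_of_isExp {M : Set E} {k : ℕ}
    {e : OpenPartialHomeomorph (Fin k → ℂ) M} (he : IsHolomorphicParametrization e) {x : M}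
    (hx : x ∈ e.target) (f : E →ₗ[ℂ] ℂ)
    (hf : HasFDerivAt (fun v => f (e v)) (0 : (Fin k → ℂ) →L[ℂ] ℂ) (e.symm x))
    (A : Module.End ℂ E) (hA : ∀ (t : ℂ) (g : E ≃ₗ[ℂ] E), IsExp (t • A) g → g x ∈ M) :
    f (A x) = 0 := by
  let := finiteDimensionalNorm E
  let := finiteDimensionalNormedSpace E
  have := FiniteDimensional.complete ℂ E
  have hmem (t : ℂ) : exp (t • LinearMap.toContinuousLinearMap A) (x : E) ∈ M := by
    obtain ⟨g, hg⟩ := exists_isExp (t • A)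
    have := hA t g hg
    rwa [(hg (x : E)).unique (hasSum_exp_apply (t • LinearMap.toContinuousLinearMap A) (x : E))]
      at this
  have hd := hasDerivAt_exp_smul_apply (LinearMap.toContinuousLinearMap A) (x : E) 0
  have := he.apply_velocity_eq_zero_normed hx f hf (γ := fun t => ⟨_, hmem t⟩)
    (Subtype.ext (by simp)) hd
  simpa using this

lemma exists_parametrization (a : E →ₗ[ℂ] Module.End ℂ E) {x : E} {O : Set E} (hx : x ∈ O)
    (hanti : ∀ y, a y x = -a x y) (hdisj : ∀ y, a x (a x y) = 0 → a x y = 0)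
    (hO : ∀ w y, ∀ g : E ≃ₗ[ℂ] E, IsExp (a w) g → (g y ∈ O ↔ y ∈ O))
    (hiso : ∀ᶠ c in 𝓝 (0 : E), a x c = 0 → x + c ∈ O → c = 0) :
    ∃ e : OpenPartialHomeomorph (Fin (finrank ℂ (LinearMap.range (a x))) → ℂ) O,
      IsHolomorphicParametrization e ∧ ⟨x, hx⟩ ∈ e.target ∧
        ∃ φ' : (Fin (finrank ℂ (LinearMap.range (a x))) → ℂ) →L[ℂ] E,
          HasFDerivAt (fun v => (e v : E)) φ' (e.symm ⟨x, hx⟩) ∧ ∀ v, ∃ y, φ' v = a x y := by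
  let := finiteDimensionalNorm E
  let := finiteDimensionalNormedSpace E
  refine exists_parametrization_normed a hx hanti hdisj (fun w y => ?_) hiso
  obtain ⟨g, hg⟩ := exists_isExp (a w)
  rw [← hO w y g hg, (hg y).unique (hasSum_exp_apply (LinearMap.toContinuousLinearMap (a w)) y)]

end Submanifold

/-! ### Eigenvalues of commuting and of small endomorphisms -/

section Semisimple

open Module Filter Topology

variable {E : Type*} [AddCommGroup E] [Module ℂ E] [FiniteDimensional ℂ E]

lemma Module.End.IsSemisimple.eq_zero_of_forall_hasEigenvalue {T : End ℂ E} (hT : T.IsSemisimple)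
    (h : ∀ μ, T.HasEigenvalue μ → μ = 0) : T = 0 := by
  have h1 := End.iSup_maxGenEigenspace_eq_top T
  simp only [hT.isFinitelySemisimple.maxGenEigenspace_eq_eigenspace] at h1
  have h2 : End.eigenspace T 0 = ⊤ := by
    refine top_unique (h1 ▸ iSup_le fun μ => ?_)
    by_cases hμ : T.HasEigenvalue μ
    · rw [h μ hμ]
    · rw [End.hasEigenvalue_iff, not_not] at hμ
      simp [hμ]
  ext y
  have : y ∈ End.eigenspace T 0 := h2 ▸ Submodule.mem_top
  simpa [End.mem_eigenspace_iff] using this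

/-- `S` preserves the eigenspaces of `T - S`, so it has an eigenvector in this one, which is then
one of `T`. -/
lemma Module.End.exists_hasEigenvalue_of_sub {S T : End ℂ E} (hST : Commute S T) {d : ℂ}
    (hd : (T - S).HasEigenvalue d) : ∃ μ, S.HasEigenvalue μ ∧ T.HasEigenvalue (μ + d) := by
  set W := End.eigenspace (T - S) d with hW
  have hmaps : ∀ y ∈ W, S y ∈ W :=
    End.mapsTo_genEigenspace_of_comm (hST.symm.sub_left (Commute.refl S)) d 1
  have : Nontrivial W := Submodule.nontrivial_iff_ne_bot.2 (End.hasEigenvalue_iff.1 hd)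
  obtain ⟨μ, hμ⟩ := End.exists_eigenvalue (S.restrict hmaps)
  obtain ⟨⟨y, hyW⟩, hy⟩ := hμ.exists_hasEigenvector
  have hy0 : y ≠ 0 := fun h => hy.2 (Subtype.ext h)
  have hS : S y = μ • y := congrArg Subtype.val (End.mem_eigenspace_iff.1 hy.1)
  have hTS : T y - S y = d • y := End.mem_eigenspace_iff.1 hyW
  refine ⟨μ, End.hasEigenvalue_of_hasEigenvector ⟨End.mem_eigenspace_iff.2 hS, hy0⟩,
    End.hasEigenvalue_of_hasEigenvector ⟨End.mem_eigenspace_iff.2 ?_, hy0⟩⟩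
  rw [add_smul, ← hS, ← hTS]
  abel

lemma eventually_not_hasEigenvalue [TopologicalSpace E] [IsTopologicalAddGroup E]
    [ContinuousSMul ℂ E] [T2Space E] (a : E →ₗ[ℂ] End ℂ E) {d : ℂ} (hd : d ≠ 0) :
    ∀ᶠ c in 𝓝 (0 : E), ¬ (a c).HasEigenvalue d := by
  let := finiteDimensionalNorm E
  let := finiteDimensionalNormedSpace E
  let a' : E →L[ℂ] E →L[ℂ] E :=
    LinearMap.toContinuousLinearMap (LinearMap.toContinuousLinearMap.toLinearMap ∘ₗ a)
  have h1 : Tendsto (fun c => ‖a' c‖) (𝓝 0) (𝓝 0) := by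
    simpa using (a'.continuous.norm).tendsto 0
  filter_upwards [h1.eventually_lt_const (norm_pos_iff.2 hd)] with c hc h
  obtain ⟨y, hy⟩ := h.exists_hasEigenvector
  have h2 : a' c y = d • y := End.mem_eigenspace_iff.1 hy.1
  have h3 := (a' c).le_opNorm y
  rw [h2, norm_smul] at h3
  exact absurd (le_of_mul_le_mul_right h3 (norm_pos_iff.2 hy.2)) (not_le.2 hc)

end Semisimple

/-! ### Terminating exponential series and infinitesimal invariance -/

section IsExp

variable {E : Type*} [AddCommGroup E] [Module ℂ E] [FiniteDimensional ℂ E]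
  [TopologicalSpace E] [IsTopologicalAddGroup E] [ContinuousSMul ℂ E] [T2Space E]

lemma IsExp.apply_of_apply_apply_apply_eq_zero {A : Module.End ℂ E} {g : E → E} (hg : IsExp A g)
    {y : E} (hy : A (A (A y)) = 0) : g y = y + A y + (2⁻¹ : ℂ) • A (A y) := by
  have h : ∀ n ∉ Finset.range 3, ((n.factorial : ℂ)⁻¹) • (A ^ n) y = 0 := fun n hn => by
    obtain ⟨m, rfl⟩ : ∃ m, n = m + 3 := ⟨n - 3, by simp at hn; omega⟩
    rw [pow_add, Module.End.mul_apply]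
    have : (A ^ 3) y = 0 := by simpa [pow_succ] using hy
    simp [this]
  have := (hg y).unique (hasSum_sum_of_ne_finset_zero h)
  simpa [Finset.sum_range_succ, pow_succ] using this

lemma MultilinearMap.comp_eq_self_of_derivationAction_eq_zero {ι : Type*} [Fintype ι]
    [DecidableEq ι] {A : Module.End ℂ E} {g : E → E} (hg : IsExp A g)
    (ω : MultilinearMap ℂ (fun _ : ι => E) ℂ) (hω : derivationAction A ω = 0) (u : ι → E) :
    ω (fun i => g (u i)) = ω u := by
  have h := hasSum_comp_exp hg ω u
  refine h.unique ?_
  convert hasSum_single (f := fun n : ℕ => ((n.factorial : ℂ)⁻¹) •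
    ((derivationAction A)^[n] ω) u) 0 fun n hn => ?_ using 1
  · simp
  · have h0 : derivationAction A (0 : MultilinearMap ℂ (fun _ : ι => E) ℂ) = 0 := by
      ext; simp [derivationAction_apply]
    obtain ⟨m, rfl⟩ := Nat.exists_eq_succ_of_ne_zero hn
    rw [Function.iterate_succ_apply, hω]
    have : (derivationAction A)^[m] (0 : MultilinearMap ℂ (fun _ : ι => E) ℂ) = 0 :=
      Function.iterate_fixed h0 m
    simp [this]

end IsExp

/-! ### Killing form and adjoint group -/

section KillingForm

variable {L : Type*} [LieRing L] [LieAlgebra ℂ L] [FiniteDimensional ℂ L]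
  [IsSemisimple ℂ L]

lemma killingForm_lie_left (x y z : L) :
    killingForm ℂ L ⁅x, y⁆ z = killingForm ℂ L x ⁅y, z⁆ :=
  LieModule.traceForm_apply_lie_apply ℂ L L x y z

lemma ext_killingForm {x y : L} (h : ∀ z, killingForm ℂ L x z = killingForm ℂ L y z) : x = y :=
  sub_eq_zero.1 <| (IsKilling.killingForm_nondegenerate ℂ L).1 _ fun z => by simp [h z]

lemma killingForm_lie_right (x y z : L) :
    killingForm ℂ L x ⁅y, z⁆ = -killingForm ℂ L ⁅y, x⁆ z := by
  rw [← killingForm_lie_left, ← lie_skew, map_neg, LinearMap.neg_apply]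

end KillingForm

section AdjointGroup

variable {L : Type*} [LieRing L] [LieAlgebra ℂ L] [FiniteDimensional ℂ L]
  [IsSemisimple ℂ L] [TopologicalSpace L] [IsTopologicalAddGroup L] [ContinuousSMul ℂ L]
  [T2Space L]

lemma IsExp.mem_adjointGroup {z : L} {g : L ≃ₗ[ℂ] L} (hg : IsExp (ad ℂ L z) g) :
    g ∈ adjointGroup L :=
  Subgroup.subset_closure ⟨z, hg⟩

lemma IsExp.killingForm_apply {z : L} {g : L → L} (hg : IsExp (ad ℂ L z) g) (x y : L) :
    killingForm ℂ L (g x) (g y) = killingForm ℂ L x y := by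
  let ω : MultilinearMap ℂ (fun _ : Fin 2 => L) ℂ :=
    .mk' (fun u => killingForm ℂ L (u 0) (u 1))
      (fun u i x y => by fin_cases i <;> simp) (fun u i c x => by fin_cases i <;> simp)
  have h := ω.comp_eq_self_of_derivationAction_eq_zero hg (by
    ext u
    have h1 : killingForm ℂ L ⁅z, u 0⁆ (u 1) + killingForm ℂ L (u 0) ⁅z, u 1⁆ = 0 := by
      rw [← lie_skew, map_neg, LinearMap.neg_apply, killingForm_lie_left]
      simp
    simpa [MultilinearMap.derivationAction_apply, ω, Fin.sum_univ_two] using h1) ![x, y]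
  simpa [ω] using h

/-- The trilinear form ⟨[x, y], w⟩ is infinitesimally invariant, hence invariant under `g`;
nondegeneracy recovers the bracket. -/
lemma IsExp.lie_apply {z : L} {g : L ≃ₗ[ℂ] L} (hg : IsExp (ad ℂ L z) g) (x y : L) :
    g ⁅x, y⁆ = ⁅g x, g y⁆ := by
  let ω : MultilinearMap ℂ (fun _ : Fin 3 => L) ℂ :=
    .mk' (fun u => killingForm ℂ L ⁅u 0, u 1⁆ (u 2))
      (fun u i x y => by fin_cases i <;> simp) (fun u i c x => by fin_cases i <;> simp)
  refine ext_killingForm fun w => ?_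
  obtain ⟨w, rfl⟩ := g.surjective w
  have h := ω.comp_eq_self_of_derivationAction_eq_zero hg (by
    ext u
    have h1 : killingForm ℂ L ⁅⁅z, u 0⁆, u 1⁆ (u 2) + killingForm ℂ L ⁅u 0, ⁅z, u 1⁆⁆ (u 2)
        + killingForm ℂ L ⁅u 0, u 1⁆ ⁅z, u 2⁆ = 0 := by
      rw [← killingForm_lie_left _ z, ← lie_skew _ z, map_neg, LinearMap.neg_apply, lie_lie z]
      simp
    simpa [MultilinearMap.derivationAction_apply, ω, Fin.sum_univ_three] using h1) ![x, y, w]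
  rw [hg.killingForm_apply]
  simpa [ω] using h.symm

lemma adjointGroup_lie_apply {g : L ≃ₗ[ℂ] L} (hg : g ∈ adjointGroup L) (x y : L) :
    g ⁅x, y⁆ = ⁅g x, g y⁆ := by
  induction hg using Subgroup.closure_induction generalizing x y with
  | mem g hg => obtain ⟨z, hz⟩ := hg; exact IsExp.lie_apply hz x y
  | one => rfl
  | mul g h _ _ ihg ihh => rw [LinearEquiv.mul_apply, ihh, ihg]; rfl
  | inv g _ ih =>
    apply g.injective
    rw [ih]
    simp only [← LinearEquiv.mul_apply, mul_inv_cancel]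
    rfl

lemma mem_adjointOrbit_iff {x y : L} : x ∈ adjointOrbit y ↔ ∃ g ∈ adjointGroup L, g y = x := by
  constructor
  · rintro ⟨g, hg⟩
    exact ⟨g, g.2, hg⟩
  · rintro ⟨g, hg, h⟩
    exact ⟨⟨g, hg⟩, h⟩

lemma adjointGroup_apply_mem_adjointOrbit_iff {g : L ≃ₗ[ℂ] L} (hg : g ∈ adjointGroup L) {x y : L} :
    g x ∈ adjointOrbit y ↔ x ∈ adjointOrbit y := by
  have : (⟨g, hg⟩ : adjointGroup L) • x ∈ MulAction.orbit (adjointGroup L) y ↔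
      x ∈ MulAction.orbit (adjointGroup L) y := by
    rw [← MulAction.orbit_eq_iff, MulAction.orbit_smul, MulAction.orbit_eq_iff]
  exact this

end AdjointGroup

/-! ### Centralizers of elements of the Cartan subalgebra -/

section CartanSubalgebra

open Module Filter Topology LieModule

variable {L : Type*} [LieRing L] [LieAlgebra ℂ L] [FiniteDimensional ℂ L]
  [IsSemisimple ℂ L] {𝔥 : LieSubalgebra ℂ L} [𝔥.IsCartanSubalgebra]

variable (𝔥) in
lemma rootSpace_induction {p : L → Prop} (hcartan : ∀ h : 𝔥, p h)
    (hroot : ∀ α ∈ 𝔥.root, ∀ x ∈ rootSpace 𝔥 α, p x) (hadd : ∀ x y, p x → p y → p (x + y))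
    (x : L) : p x := by
  have hx : x ∈ (⨆ χ : Weight ℂ 𝔥 L, (rootSpace 𝔥 χ).toSubmodule) := by
    rw [← LieSubmodule.iSup_toSubmodule, iSup_genWeightSpace_eq_top' ℂ 𝔥 L]
    trivial
  refine Submodule.iSup_induction _ (motive := p) hx (fun χ y hy => ?_) (hcartan 0) hadd
  by_cases hχ : χ.IsZero
  · have h0 : (χ : 𝔥 → ℂ) = 0 := hχ
    rw [h0] at hy
    have hy' : y ∈ rootSpace 𝔥 (0 : 𝔥 → ℂ) := hy
    rw [rootSpace_zero_eq] at hy'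
    exact hcartan ⟨y, hy'⟩
  · exact hroot χ (by simpa using hχ) y hy

lemma cartan_lie_eq_zero {x y : L} (hx : x ∈ 𝔥) (hy : y ∈ 𝔥) : ⁅x, y⁆ = 0 :=
  congrArg Subtype.val (LieModule.IsTrivial.trivial (⟨x, hx⟩ : 𝔥) (⟨y, hy⟩ : 𝔥))

lemma cartan_lie_eq_smul {α : 𝔥 → ℂ} {x : L} (hx : x ∈ rootSpace 𝔥 α) (h : 𝔥) :
    ⁅(h : L), x⁆ = α h • x :=
  IsKilling.lie_eq_smul_of_mem_rootSpace hx h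

/-- The centralizer of a regular element of `𝔥` is `𝔥`. -/
lemma IsRegularElement.lie_eq_zero_iff {H : 𝔥} (hH : IsRegularElement H) {x : L} :
    ⁅(H : L), x⁆ = 0 ↔ x ∈ 𝔥 := by
  refine ⟨fun hx => ?_, fun hx => cartan_lie_eq_zero H.2 hx⟩
  have horth : ∀ α ∈ 𝔥.root, ∀ y ∈ rootSpace 𝔥 α, killingForm ℂ L x y = 0 := fun α hα y hy => by
    have h1 := killingForm_lie_right x (H : L) y
    rw [hx, cartan_lie_eq_smul hy] at h1
    simpa [hH α hα] using h1
  -- As 𝔥 is its own normalizer, it is enough that x commutes with 𝔥. Now ⟨[h, x], y⟩ = -⟨x, [h, y]⟩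
  -- vanishes for y in 𝔥 and, by `horth`, for y in a root space.
  rw [← LieSubalgebra.IsCartanSubalgebra.self_normalizing (H := 𝔥),
    LieSubalgebra.mem_normalizer_iff]
  intro h hh
  suffices ⁅h, x⁆ = 0 by rw [← lie_skew, this, neg_zero]; exact zero_mem _
  refine ext_killingForm fun y => ?_
  rw [map_zero, LinearMap.zero_apply, ← neg_eq_zero, ← killingForm_lie_right]
  induction y using rootSpace_induction 𝔥 with
  | hcartan k => rw [cartan_lie_eq_zero hh k.2, map_zero]
  | hroot α hα y hy => rw [cartan_lie_eq_smul hy ⟨h, hh⟩, map_smul, horth α hα y hy, smul_zero]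
  | hadd y z hy hz => rw [lie_add, map_add, hy, hz, add_zero]

lemma isSemisimple_ad (H : 𝔥) : (ad ℂ L (H : L)).IsSemisimple :=
  IsKilling.isSemisimple_ad_of_mem_isCartanSubalgebra H.2

lemma lie_eq_zero_of_lie_lie_eq_zero (H : 𝔥) {y : L} (hy : ⁅(H : L), ⁅(H : L), y⁆⁆ = 0) :
    ⁅(H : L), y⁆ = 0 := by
  have h := (isSemisimple_ad H).isFinitelySemisimple.genEigenspace_eq_eigenspace 0
    (k := 2) (by norm_num)
  have h1 : y ∈ (ad ℂ L (H : L)).genEigenspace 0 (2 : ℕ) := by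
    rw [End.mem_genEigenspace_nat]
    simpa [pow_two] using hy
  have h2 : y ∈ (ad ℂ L (H : L)).eigenspace 0 := h ▸ h1
  simpa [End.mem_eigenspace_iff] using h2

lemma eq_zero_of_ad_eq_zero {x : L} (hx : ad ℂ L x = 0) : x = 0 :=
  ext_killingForm fun z => by simp [killingForm_apply_apply, hx]

variable [TopologicalSpace L] [IsTopologicalAddGroup L] [ContinuousSMul ℂ L] [T2Space L]

/-- S = ad H and T = ad(H + c) are commuting conjugate semisimple maps, so ad c = T - S is
semisimple and its eigenvalues are differences of eigenvalues of S. These form a finite set, and a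
small c excludes the nonzero ones; thus ad c = 0. -/
lemma eventually_eq_zero_of_add_mem_adjointOrbit (H : 𝔥) :
    ∀ᶠ c in 𝓝 (0 : L), ⁅(H : L), c⁆ = 0 → (H : L) + c ∈ adjointOrbit (H : L) → c = 0 := by
  set S := ad ℂ L (H : L) with hS
  set D : Set ℂ := (fun p : ℂ × ℂ => p.1 - p.2) ''
    ({μ | S.HasEigenvalue μ} ×ˢ {μ | S.HasEigenvalue μ}) \ {0} with hD
  have hfin : D.Finite := ((S.finite_hasEigenvalue.prod S.finite_hasEigenvalue).image _).sdiff
  have h1 : ∀ᶠ c in 𝓝 (0 : L), ∀ d ∈ D, ¬ (ad ℂ L c).HasEigenvalue d :=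
    (eventually_all_finite hfin).2 fun d hd =>
      eventually_not_hasEigenvalue (ad ℂ L : L →ₗ[ℂ] End ℂ L) hd.2
  filter_upwards [h1] with c hc hcomm hmem
  obtain ⟨g, hg, hgH⟩ := mem_adjointOrbit_iff.1 hmem
  set T := ad ℂ L ((H : L) + c) with hT
  have hTS : ad ℂ L c = T - S := by rw [hT, hS, map_add, add_sub_cancel_left]
  have hgST : (g : L →ₗ[ℂ] L) ∘ₗ S = T ∘ₗ g := by
    ext y
    simp only [hS, hT, ← hgH, LinearMap.comp_apply, LinearEquiv.coe_coe, ad_apply]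
    exact adjointGroup_lie_apply hg _ _
  have hTss : T.IsSemisimple := (LinearEquiv.isSemisimple_iff S T g hgST).1 (isSemisimple_ad H)
  have hTev : ∀ μ, T.HasEigenvalue μ → S.HasEigenvalue μ := fun μ hμ => by
    obtain ⟨y, hy⟩ := hμ.exists_hasEigenvector
    obtain ⟨u, rfl⟩ := g.surjective y
    refine End.hasEigenvalue_of_hasEigenvector (x := u)
      ⟨End.mem_eigenspace_iff.2 (g.injective ?_), fun h => hy.2 (by simp [h])⟩
    have h2 := End.mem_eigenspace_iff.1 hy.1
    rw [map_smul, ← h2]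
    exact congr($hgST u)
  have hcommST : Commute S T := by
    refine LinearMap.ext fun y => ?_
    simp only [hS, hT, Module.End.mul_apply, ad_apply]
    rw [leibniz_lie, lie_add, lie_self, hcomm, add_zero, zero_lie, zero_add]
  refine eq_zero_of_ad_eq_zero ?_
  rw [hTS]
  refine (hTss.sub_of_commute hcommST.symm (isSemisimple_ad H)).eq_zero_of_forall_hasEigenvalue
    fun d hd => ?_
  by_contra hd0
  obtain ⟨μ, hμ, hμd⟩ := End.exists_hasEigenvalue_of_sub hcommST hd
  exact hc d ⟨⟨(μ + d, μ), ⟨hTev _ hμd, hμ⟩, by simp⟩, hd0⟩ (hTS ▸ hd)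

end CartanSubalgebra

/-! ### Charts on the adjoint orbit and critical points -/

section OrbitManifold

open Module

variable {L : Type*} [LieRing L] [LieAlgebra ℂ L] [FiniteDimensional ℂ L]
  [IsSemisimple ℂ L] [TopologicalSpace L] [IsTopologicalAddGroup L] [ContinuousSMul ℂ L]
  [T2Space L] {𝔥 : LieSubalgebra ℂ L} [𝔥.IsCartanSubalgebra]

lemma exists_adjointOrbit_parametrization (H₀ : 𝔥) (x : adjointOrbit (H₀ : L)) :
    ∃ e : OpenPartialHomeomorph (Fin (finrank ℂ (LinearMap.range (ad ℂ L (H₀ : L)))) → ℂ)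
      (adjointOrbit (H₀ : L)), IsHolomorphicParametrization e ∧ x ∈ e.target ∧
        ∃ φ' : (Fin (finrank ℂ (LinearMap.range (ad ℂ L (H₀ : L)))) → ℂ) →L[ℂ] L,
          HasFDerivAt (fun v => (e v : L)) φ' (e.symm x) ∧ ∀ v, ∃ y, φ' v = ⁅(x : L), y⁆ := by
  obtain ⟨e, he, het, φ', hφ, hrange⟩ := exists_parametrization (ad ℂ L : L →ₗ[ℂ] End ℂ L)
    (x := (H₀ : L)) (O := adjointOrbit (H₀ : L)) (MulAction.mem_orbit_self _)
    (fun y => (lie_skew _ _).symm) (fun y hy => lie_eq_zero_of_lie_lie_eq_zero H₀ hy)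
    (fun w y g hg => adjointGroup_apply_mem_adjointOrbit_iff (IsExp.mem_adjointGroup hg))
    (eventually_eq_zero_of_add_mem_adjointOrbit H₀)
  obtain ⟨g, hg, hgx⟩ := mem_adjointOrbit_iff.1 x.2
  let := finiteDimensionalNorm L
  let := finiteDimensionalNormedSpace L
  let g' : L ≃L[ℂ] L := g.toContinuousLinearEquiv
  let G : adjointOrbit (H₀ : L) ≃ₜ adjointOrbit (H₀ : L) :=
    g'.toHomeomorph.subtype fun y => (adjointGroup_apply_mem_adjointOrbit_iff hg).symm
  have hG : G ⟨H₀, MulAction.mem_orbit_self _⟩ = x := Subtype.ext hgx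
  have hGx : G.symm x = ⟨H₀, MulAction.mem_orbit_self _⟩ := by rw [← hG, G.symm_apply_apply]
  have hder {v φ} (h : HasFDerivAt (fun v => (e v : L)) φ v) :
      HasFDerivAt (fun v => (e.transHomeomorph G v : L)) ((g' : L →L[ℂ] L).comp φ) v :=
    (g' : L →L[ℂ] L).hasFDerivAt.comp v h
  refine ⟨e.transHomeomorph G, fun u hu => ?_, ?_, (g' : L →L[ℂ] L).comp φ', ?_, fun v => ?_⟩
  · obtain ⟨φ, hφ, hinj⟩ := he u hu
    exact ⟨_, hder hφ, g'.injective.comp hinj⟩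
  · change G.symm x ∈ e.target
    rwa [hGx]
  · change HasFDerivAt _ _ (e.symm (G.symm x))
    rw [hGx]
    exact hder hφ
  · obtain ⟨y, hy⟩ := hrange v
    refine ⟨g y, ?_⟩
    rw [← hgx, ← adjointGroup_lie_apply hg]
    exact congrArg g hy

lemma isComplexSubmanifold_adjointOrbit (H₀ : 𝔥) : IsComplexSubmanifold (adjointOrbit (H₀ : L)) :=
  ⟨_, fun x => (exists_adjointOrbit_parametrization H₀ x).imp fun _ h => ⟨h.1, h.2.1⟩⟩

/-- One direction tests an arbitrary chart on the curves exp(t ad z) x; the other uses a chart whose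
derivative takes values in [x, 𝔤]. -/
lemma isCriticalPoint_heightFunction_iff {H₀ : 𝔥} {H : L} (x : adjointOrbit (H₀ : L)) :
    IsCriticalPoint (heightFunction H (H₀ : L)) x ↔ ⁅H, (x : L)⁆ = 0 := by
  constructor
  · rintro ⟨k, e, he, hx, hf⟩
    refine ext_killingForm fun z => ?_
    have h := he.apply_eq_zero_of_isExp hx (killingForm ℂ L H) hf (ad ℂ L z) fun t g hg =>
      (adjointGroup_apply_mem_adjointOrbit_iff
        (IsExp.mem_adjointGroup (z := t • z) (by rwa [map_smul]))).2 x.2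
    rw [killingForm_lie_left, ← lie_skew, map_neg]
    simpa using h
  · intro hx
    obtain ⟨e, he, hxe, φ', hφ, hrange⟩ := exists_adjointOrbit_parametrization H₀ x
    refine ⟨_, e, he, hxe, ?_⟩
    let := finiteDimensionalNorm L
    let := finiteDimensionalNormedSpace L
    have h := (LinearMap.toContinuousLinearMap (killingForm ℂ L H)).hasFDerivAt.comp _ hφ
    refine h.congr_fderiv (ContinuousLinearMap.ext fun v => ?_)
    obtain ⟨y, hy⟩ := hrange v
    change killingForm ℂ L H (φ' v) = 0
    rw [hy, ← killingForm_lie_left, hx, map_zero, LinearMap.zero_apply]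

end OrbitManifold

/-! ### The Weyl orbit lies in the adjoint orbit -/

section WeylOrbit

open LieModule

variable {L : Type*} [LieRing L] [LieAlgebra ℂ L] [FiniteDimensional ℂ L]
  [IsSemisimple ℂ L] {𝔥 : LieSubalgebra ℂ L} [𝔥.IsCartanSubalgebra]

lemma self_mem_weylOrbit (H : 𝔥) : H ∈ weylOrbit H := MulAction.mem_orbit_self _

lemma sub_smul_coroot_mem_weylOrbit {H y : 𝔥} (hy : y ∈ weylOrbit H) (α : 𝔥.root) :
    y - α.1 y • IsKilling.coroot α.1 ∈ weylOrbit H := by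
  obtain ⟨w, rfl⟩ := hy
  exact ⟨⟨MulOpposite.op (RootPairing.Equiv.reflection (IsKilling.rootSystem 𝔥) α),
    RootPairing.reflection_mem_weylGroup _ _⟩ * w, mul_smul _ w H⟩

lemma weylOrbit_induction {H : 𝔥} {p : 𝔥 → Prop} (hself : p H)
    (hrefl : ∀ y, p y → ∀ α : 𝔥.root, p (y - α.1 y • IsKilling.coroot α.1))
    {y : 𝔥} (hy : y ∈ weylOrbit H) : p y := by
  obtain ⟨⟨w, hw⟩, rfl⟩ := hy
  have key : ∀ σ ∈ (IsKilling.rootSystem 𝔥).weylGroup, ∀ y, p y → p (MulOpposite.op σ • y) := by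
    intro σ hσ
    induction hσ using RootPairing.weylGroup.induction with
    | mem α => exact fun y hy => hrefl y hy α
    | one => exact fun y hy => hy
    -- In the opposite group the product στ acts by σ first.
    | mul σ τ _ _ hσ hτ => exact fun y hy => hτ _ (hσ y hy)
  exact key w.unop hw H hself

end WeylOrbit

section WeylReflection

open LieModule

variable {L : Type*} [LieRing L] [LieAlgebra ℂ L] [FiniteDimensional ℂ L]
  [IsSemisimple ℂ L] [TopologicalSpace L] [IsTopologicalAddGroup L] [ContinuousSMul ℂ L]
  [T2Space L] {𝔥 : LieSubalgebra ℂ L} [𝔥.IsCartanSubalgebra]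

/-- The reflection in a root is induced by `exp (ad e) exp (-ad f) exp (ad e)`. -/
lemma exists_adjointGroup_apply_eq_reflection (α : 𝔥.root) :
    ∃ g ∈ adjointGroup L, ∀ y : 𝔥, g y = (y - α.1 y • IsKilling.coroot α.1 : 𝔥) := by
  have hα := 𝔥.isNonZero_coe_root α
  obtain ⟨h, e, f, t, he, hf⟩ := IsKilling.exists_isSl2Triple_of_weight_isNonZero hα
  have hh := t.h_eq_coroot hα he hf
  obtain ⟨g, hg⟩ := exists_isExp (ad ℂ L e)
  obtain ⟨k, hk⟩ := exists_isExp (ad ℂ L (-f))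
  have hey (y : 𝔥) : ⁅e, (y : L)⁆ = -(α.1 y • e) := by
    rw [← lie_skew, cartan_lie_eq_smul he]
  have hfy (y : 𝔥) : ⁅f, (y : L)⁆ = α.1 y • f := by
    rw [← lie_skew, cartan_lie_eq_smul hf]; simp
  have heh : ⁅e, h⁆ = -((2 : ℂ) • e) := by rw [← lie_skew, t.lie_h_e_smul ℂ]
  have hfh : ⁅f, h⁆ = (2 : ℂ) • f := by rw [← lie_skew, t.lie_lie_smul_f ℂ, neg_neg]
  -- These brackets make every exponential series below stop at the quadratic term.
  have hfe : ⁅f, e⁆ = -h := by rw [← lie_skew, t.lie_e_f]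
  have g_cartan (y : 𝔥) : g y = y - α.1 y • e := by
    rw [hg.apply_of_apply_apply_apply_eq_zero (by simp [hey])]
    simp [hey, sub_eq_add_neg]
  have g_e : g e = e := by
    rw [hg.apply_of_apply_apply_apply_eq_zero (by simp)]
    simp
  have g_h : g h = h - (2 : ℂ) • e := by
    rw [hg.apply_of_apply_apply_apply_eq_zero (by simp [heh])]
    simp [heh, sub_eq_add_neg]
  have k_cartan (y : 𝔥) : k y = y - α.1 y • f := by
    rw [hk.apply_of_apply_apply_apply_eq_zero (by simp [hfy])]
    simp [hfy, sub_eq_add_neg]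
  have k_e : k e = e + h - f := by
    rw [hk.apply_of_apply_apply_apply_eq_zero (by simp [hfe, hfh])]
    simp [hfe, hfh, sub_eq_add_neg]
  refine ⟨g * k * g, mul_mem (mul_mem (IsExp.mem_adjointGroup hg) (IsExp.mem_adjointGroup hk))
    (IsExp.mem_adjointGroup hg), fun y => ?_⟩
  have hgkg : g (k (g y)) = y - α.1 y • h := by
    have h1 : k (g y) = y - α.1 y • e - α.1 y • h := by
      rw [g_cartan, map_sub, map_smul, k_cartan, k_e]
      module
    rw [h1, map_sub, map_sub, map_smul, map_smul, g_cartan, g_e, g_h]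
    module
  rw [LinearEquiv.mul_apply, LinearEquiv.mul_apply, hgkg, hh]
  simp

lemma mem_adjointOrbit_of_mem_weylOrbit {H y : 𝔥} (hy : y ∈ weylOrbit H) :
    (y : L) ∈ adjointOrbit (H : L) := by
  refine weylOrbit_induction (p := fun y => (y : L) ∈ adjointOrbit (H : L))
    (MulAction.mem_orbit_self _) (fun y hy α => ?_) hy
  obtain ⟨g, hg, h⟩ := exists_adjointGroup_apply_eq_reflection α
  rw [← h y]
  exact (adjointGroup_apply_mem_adjointOrbit_iff hg).2 hy

end WeylReflection

/-! ### Derivations and exponentials on alternating forms -/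

section AlternatingForms

variable {ι E : Type*} [Fintype ι] [DecidableEq ι] [AddCommGroup E] [Module ℂ E]

/-- The action of an endomorphism `A` on alternating forms by
`(A • ω) u = ∑ᵢ ω (u₁, …, A uᵢ, …, uₖ)`. -/
def AlternatingMap.derivationAction (A : Module.End ℂ E) :
    (E [⋀^ι]→ₗ[ℂ] ℂ) →ₗ[ℂ] (E [⋀^ι]→ₗ[ℂ] ℂ) where
  toFun ω :=
    { MultilinearMap.derivationAction A ω.toMultilinearMap with
      map_eq_zero_of_eq' := fun u i j hij hne => by
        change MultilinearMap.derivationAction A ω.toMultilinearMap u = 0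
        -- When u i = u j, only the terms i and j survive, and they are exchanged, with a sign, by
        -- the transposition.
        rw [MultilinearMap.derivationAction_apply, ← Finset.sum_subset (Finset.subset_univ {i, j}),
          Finset.sum_pair hne]
        · have h := ω.map_swap (Function.update u i (A (u i))) hne
          have hu : Function.update u i (A (u i)) ∘ Equiv.swap i j =
              Function.update u j (A (u j)) := by
            funext l
            rcases eq_or_ne l i with rfl | hli
            · simp [hne.symm, hij, hne]
            · rcases eq_or_ne l j with rfl | hlj
              · simp [hij]
              · simp [Equiv.swap_apply_of_ne_of_ne hli hlj, hli, hlj]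
          rw [hu] at h
          change ω _ + ω _ = 0
          rw [h, add_neg_cancel]
        · intro l _ hl
          simp only [Finset.mem_insert, Finset.mem_singleton, not_or] at hl
          refine ω.map_eq_zero_of_eq _ ?_ hne
          simp [Function.update_of_ne (Ne.symm hl.1), Function.update_of_ne (Ne.symm hl.2), hij] }
  map_add' ω ω' := by
    ext u
    change MultilinearMap.derivationAction A _ u = MultilinearMap.derivationAction A _ u +
      MultilinearMap.derivationAction A _ u
    simp [MultilinearMap.derivationAction_apply, Finset.sum_add_distrib]
  map_smul' c ω := by
    ext u
    change MultilinearMap.derivationAction A _ u = c • MultilinearMap.derivationAction A _ u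
    simp [MultilinearMap.derivationAction_apply, Finset.mul_sum]

lemma AlternatingMap.derivationAction_apply (A : Module.End ℂ E) (ω : E [⋀^ι]→ₗ[ℂ] ℂ) (u : ι → E) :
    derivationAction A ω u = ∑ i, ω (Function.update u i (A (u i))) :=
  MultilinearMap.derivationAction_apply A ω.toMultilinearMap u

lemma AlternatingMap.derivationAction_add (A B : Module.End ℂ E) (ω : E [⋀^ι]→ₗ[ℂ] ℂ) :
    derivationAction (A + B) ω = derivationAction A ω + derivationAction B ω := by
  ext u
  simp [derivationAction_apply, Finset.sum_add_distrib]

lemma AlternatingMap.derivationAction_smul (c : ℂ) (A : Module.End ℂ E) (ω : E [⋀^ι]→ₗ[ℂ] ℂ) :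
    derivationAction (c • A) ω = c • derivationAction A ω := by
  ext u
  simp [derivationAction_apply, Finset.mul_sum]

/-- Terms altering two different slots agree on both sides; the terms altering one slot twice leave
the commutator, in reversed order because forms are contravariant. -/
lemma AlternatingMap.derivationAction_comm (A B : Module.End ℂ E) (ω : E [⋀^ι]→ₗ[ℂ] ℂ) :
    derivationAction A (derivationAction B ω) =
      derivationAction B (derivationAction A ω) + derivationAction (B * A - A * B) ω := by
  ext u
  have key (i j : ι) :
      ω (Function.update (Function.update u i (A (u i))) j
        (B (Function.update u i (A (u i)) j))) =
      ω (Function.update (Function.update u j (B (u j))) i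
        (A (Function.update u j (B (u j)) i))) +
      if j = i then ω (Function.update u i ((B * A - A * B) (u i))) else 0 := by
    rcases eq_or_ne j i with rfl | h
    · simp [ω.map_update_sub]
    · simp [h, h.symm, Function.update_comm h]
  simp only [derivationAction_apply, AlternatingMap.add_apply, key, Finset.sum_add_distrib,
    Finset.sum_ite_eq', Finset.mem_univ, if_true]
  rw [Finset.sum_comm]

lemma AlternatingMap.apply_comp_exp_eq_zero [FiniteDimensional ℂ E] [TopologicalSpace E]
    [IsTopologicalAddGroup E] [ContinuousSMul ℂ E] [T2Space E]
    {A : Module.End ℂ E} {g : E → E} (hg : IsExp A g)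
    (N : Submodule ℂ (E [⋀^ι]→ₗ[ℂ] ℂ)) (hN : ∀ ω ∈ N, derivationAction A ω ∈ N) {u : ι → E}
    (hu : ∀ ω ∈ N, ω u = 0) {ω : E [⋀^ι]→ₗ[ℂ] ℂ} (hω : ω ∈ N) : ω (fun i => g (u i)) = 0 := by
  have h := MultilinearMap.hasSum_comp_exp hg ω.toMultilinearMap u
  refine h.unique ?_
  convert hasSum_zero with n
  have hn : (derivationAction A)^[n] ω ∈ N ∧ ((derivationAction A)^[n] ω).toMultilinearMap =
      (MultilinearMap.derivationAction A)^[n] ω.toMultilinearMap := by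
    induction n with
    | zero => exact ⟨hω, rfl⟩
    | succ n ih =>
      rw [Function.iterate_succ_apply', Function.iterate_succ_apply', ← ih.2]
      exact ⟨hN _ ih.1, rfl⟩
  rw [← hn.2]
  have := hu _ hn.1
  change _ • ((derivationAction A)^[n] ω) u = 0
  rw [this, smul_zero]

/-- The determinant form of a family `φ` of eigenvectors of the transpose of `A` is an eigenvector
for the action of `A`, the eigenvalue being the sum of the eigenvalues. -/
lemma AlternatingMap.derivationAction_det (A : Module.End ℂ E) (φ : ι → E →ₗ[ℂ] ℂ) (a : ι → ℂ)
    (h : ∀ i u, φ i (A u) = a i * φ i u) :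
    derivationAction A ((Matrix.detRowAlternating (R := ℂ) (n := ι)).compLinearMap
        (LinearMap.pi φ)) =
      (∑ i, a i) • (Matrix.detRowAlternating (R := ℂ) (n := ι)).compLinearMap (LinearMap.pi φ) := by
  have hdet (u : ι → E) : (Matrix.detRowAlternating (R := ℂ) (n := ι)).compLinearMap
      (LinearMap.pi φ) u = ∑ σ : Equiv.Perm ι, (Equiv.Perm.sign σ : ℂ) * ∏ i, φ (σ i) (u i) := by
    change Matrix.det (Matrix.of fun i j => φ j (u i)) = _
    rw [← Matrix.det_transpose, Matrix.det_apply']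
    rfl
  have hupd (u : ι → E) (σ : Equiv.Perm ι) (r : ι) :
      ∏ i, φ (σ i) (Function.update u r (A (u r)) i) = a (σ r) * ∏ i, φ (σ i) (u i) := by
    rw [← Finset.mul_prod_erase _ _ (Finset.mem_univ r),
      ← Finset.mul_prod_erase _ (fun i => φ (σ i) (u i)) (Finset.mem_univ r)]
    rw [Function.update_self, h, mul_assoc]
    congr 2
    refine Finset.prod_congr rfl fun i hi => ?_
    rw [Function.update_of_ne (Finset.ne_of_mem_erase hi)]
  ext u
  rw [derivationAction_apply, AlternatingMap.smul_apply]
  simp only [hdet, hupd]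
  rw [Finset.sum_comm, Finset.smul_sum]
  refine Finset.sum_congr rfl fun σ _ => ?_
  rw [← Finset.mul_sum, ← Finset.sum_mul, Equiv.sum_comp σ a, smul_eq_mul]
  ring

end AlternatingForms

/-! ### Summation over levels and generic real forms -/

section LayerCake

/-- Abel summation: split off the minimum of `a` times ∑ d; the remaining weights vanish at a
minimizer, so the induction runs over fewer indices with shifted thresholds. -/
lemma sum_mul_nonneg_of_forall_sum_filter_nonneg {ι : Type*} (s : Finset ι) (a d : ι → ℝ)
    (ha : ∀ i ∈ s, 0 < a i) (h : ∀ c : ℝ, 0 ≤ c → 0 ≤ ∑ i ∈ s with c < a i, d i) :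
    0 ≤ ∑ i ∈ s, a i * d i := by
  induction hn : s.card using Nat.strong_induction_on generalizing s a with
  | _ n ih =>
    rcases s.eq_empty_or_nonempty with rfl | hs
    · simp
    obtain ⟨m, hm, hmin⟩ := s.exists_min_image a hs
    have h1 : 0 ≤ ∑ i ∈ s, d i := by
      have := h 0 le_rfl
      rwa [Finset.filter_true_of_mem ha] at this
    have h2 : 0 ≤ ∑ i ∈ s with a m < a i, (a i - a m) * d i := by
      refine ih _ ?_ _ (fun i => a i - a m) (fun i hi => sub_pos.2 (Finset.mem_filter.1 hi).2)
        (fun c hc => ?_) rfl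
      · rw [← hn]
        exact Finset.card_lt_card (Finset.filter_ssubset.2 ⟨m, hm, lt_irrefl _⟩)
      · have := h (c + a m) (add_nonneg hc (ha m hm).le)
        convert this using 2
        ext i
        simp only [Finset.mem_filter]
        constructor
        · rintro ⟨⟨hi, -⟩, h⟩
          exact ⟨hi, by linarith⟩
        · rintro ⟨hi, h⟩
          exact ⟨⟨hi, by linarith⟩, by linarith⟩
    have h3 : ∑ i ∈ s with a m < a i, (a i - a m) * d i = ∑ i ∈ s, (a i - a m) * d i := by
      refine Finset.sum_filter_of_ne fun i hi hne => lt_of_le_of_ne (hmin i hi) fun heq => hne ?_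
      rw [heq, sub_self, zero_mul]
    rw [h3] at h2
    have h4 : ∑ i ∈ s, a i * d i = a m * ∑ i ∈ s, d i + ∑ i ∈ s, (a i - a m) * d i := by
      rw [Finset.mul_sum, ← Finset.sum_add_distrib]
      exact Finset.sum_congr rfl fun i _ => by ring
    rw [h4]
    exact add_nonneg (mul_nonneg (ha m hm).le h1) h2

end LayerCake

/-- Take Re + t Im for a real t avoiding finitely many values. Root values are complex, and such a
form orders them without losing the relevant differences. -/
lemma exists_real_linear_form_injOn {F : Set ℂ} (hF : F.Finite) :
    ∃ τ : ℂ →ₗ[ℝ] ℝ, ∀ z ∈ F, τ z = 0 → z = 0 := by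
  obtain ⟨t, ht⟩ := (hF.image fun z => -z.re / z.im).infinite_compl.nonempty
  refine ⟨Complex.reLm + t • Complex.imLm, fun z hz h => ?_⟩
  have h : z.re + t * z.im = 0 := h
  by_cases him : z.im = 0
  · exact Complex.ext (by simpa [him] using h) him
  · refine absurd ⟨z, hz, ?_⟩ ht
    field_simp
    linarith

/-! ### Root vectors and upper sets of roots -/

section RootVectors

open LieModule

variable {L : Type*} [LieRing L] [LieAlgebra ℂ L] [FiniteDimensional ℂ L]
  [IsSemisimple ℂ L] {𝔥 : LieSubalgebra ℂ L} [𝔥.IsCartanSubalgebra]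

lemma exists_dual_rootVectors (α : 𝔥.root) :
    ∃ e ∈ rootSpace 𝔥 α.1, ∃ f ∈ rootSpace 𝔥 (-α.1), killingForm ℂ L f e = 1 := by
  obtain ⟨h, e, f, t, he, hf⟩ :=
    IsKilling.exists_isSl2Triple_of_weight_isNonZero (𝔥.isNonZero_coe_root α)
  have h1 := IsKilling.lie_eq_killingForm_smul_of_mem_rootSpace_of_mem_rootSpace_neg he hf
  have h2 : killingForm ℂ L e f ≠ 0 := fun h0 => t.h_ne_zero <| by
    rw [← t.lie_e_f, h1, h0, zero_smul]
  refine ⟨e, he, (killingForm ℂ L e f)⁻¹ • f, Submodule.smul_mem _ _ hf, ?_⟩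
  have h3 : killingForm ℂ L f e = killingForm ℂ L e f := traceForm_comm ℂ L L f e
  rw [map_smul, LinearMap.smul_apply, h3, smul_eq_mul, inv_mul_cancel₀ h2]

lemma killingForm_eq_zero_of_mem_rootSpace {α β : 𝔥.root} (h : α ≠ β) {e f : L}
    (he : e ∈ rootSpace 𝔥 β.1) (hf : f ∈ rootSpace 𝔥 (-α.1)) : killingForm ℂ L f e = 0 := by
  refine LieAlgebra.killingForm_apply_eq_zero_of_mem_rootSpace_of_add_ne_zero ℂ L 𝔥 hf he
    fun h0 => h (Subtype.ext (DFunLike.coe_injective ?_))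
  exact neg_add_eq_zero.1 h0

lemma exists_eq_smul_of_mem_rootSpace {α : 𝔥.root} {e x : L} (he : e ∈ rootSpace 𝔥 α.1)
    (he0 : e ≠ 0) (hx : x ∈ rootSpace 𝔥 α.1) : ∃ s : ℂ, x = s • e := by
  have h := IsKilling.finrank_rootSpace_eq_one α.1 (𝔥.isNonZero_coe_root α)
  obtain ⟨s, hs⟩ := (finrank_eq_one_iff_of_nonzero' (⟨e, he⟩ : rootSpace 𝔥 α.1)
    (fun h => he0 (congrArg Subtype.val h))).1 h ⟨x, hx⟩
  exact ⟨s, (congrArg Subtype.val hs).symm⟩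

/-- The wedge product of the root vectors of an upper set of roots is killed by nonnegative root
vectors. -/
lemma AlternatingMap.derivationAction_ad_rootVector_eq_zero {τ : ℂ →ₗ[ℝ] ℝ} {H : 𝔥} {c : ℝ}
    (hc : 0 ≤ c) {e : {α : 𝔥.root // c < τ (α.1 H)} → L} (he : ∀ α, e α ∈ rootSpace 𝔥 α.1.1)
    (he0 : ∀ α, e α ≠ 0) {γ : Weight ℂ 𝔥 L} (hγ : γ ∈ 𝔥.root) (hγτ : 0 ≤ τ (γ H)) {x : L}
    (hx : x ∈ rootSpace 𝔥 γ)
    [Fintype {α : 𝔥.root // c < τ (α.1 H)}] [DecidableEq {α : 𝔥.root // c < τ (α.1 H)}]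
    (ω : L [⋀^{α : 𝔥.root // c < τ (α.1 H)}]→ₗ[ℂ] ℂ) : derivationAction (ad ℂ L x) ω e = 0 := by
  rw [derivationAction_apply]
  refine Finset.sum_eq_zero fun α _ => ?_
  by_cases h0 : ⁅x, e α⁆ = 0
  · rw [ad_apply, h0]
    exact ω.toMultilinearMap.map_update_zero e α
  have hmem : ⁅x, e α⁆ ∈ rootSpace 𝔥 ((γ : 𝔥 → ℂ) + α.1.1) :=
    lie_mem_genWeightSpace_of_mem_genWeightSpace hx (he α)
  have hval : c < τ (((γ : 𝔥 → ℂ) + α.1.1) H) := by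
    rw [Pi.add_apply, map_add]
    exact lt_add_of_nonneg_of_lt hγτ α.2
  -- If the bracket is nonzero, γ + α is again a root of the upper set (it is not zero because c ≥
  -- 0), so the bracket is a multiple of another entry of `e` and the form sees a repeated vector.
  let β : Weight ℂ 𝔥 L := ⟨(γ : 𝔥 → ℂ) + α.1.1, fun hbot => h0 (by
    have hmem' : ⁅x, e α⁆ ∈ (⊥ : LieSubmodule ℂ 𝔥 L) := hbot ▸ hmem
    simpa using hmem')⟩
  have hβ : β ∈ 𝔥.root := by
    simp only [LieSubalgebra.root, Finset.mem_filter, Finset.mem_univ, true_and]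
    intro hz
    have hz' : (γ : 𝔥 → ℂ) + α.1.1 = 0 := hz
    have h1 : ((γ : 𝔥 → ℂ) + α.1.1) H = 0 := congrFun hz' H
    rw [h1] at hval
    exact absurd hval (not_lt.2 ((τ.map_zero).trans_le hc))
  obtain ⟨s, hs⟩ := exists_eq_smul_of_mem_rootSpace (he ⟨⟨β, hβ⟩, hval⟩) (he0 _) hmem
  rw [ad_apply, hs, ω.map_update_smul, ω.map_update_self, smul_zero]
  intro hαβ
  have h1 : (α.1.1 : 𝔥 → ℂ) = γ + α.1.1 := congrArg (fun δ => (δ.1.1 : 𝔥 → ℂ)) hαβ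
  have h2 : (γ : 𝔥 → ℂ) = 0 := by simpa using h1
  simp only [LieSubalgebra.root, Finset.mem_filter, Finset.mem_univ, true_and] at hγ
  exact hγ h2

end RootVectors

/-! ### The highest weight argument -/

section HighestWeight

open LieModule AlternatingMap

variable {L : Type*} [LieRing L] [LieAlgebra ℂ L] [FiniteDimensional ℂ L]
  [IsSemisimple ℂ L] [TopologicalSpace L] [IsTopologicalAddGroup L] [ContinuousSMul ℂ L]
  [T2Space L] {ι : Type*} [Fintype ι] [DecidableEq ι]

lemma derivationAction_ad_comm (x y : L) (ω : L [⋀^ι]→ₗ[ℂ] ℂ) :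
    derivationAction (ad ℂ L x) (derivationAction (ad ℂ L y) ω) =
      derivationAction (ad ℂ L y) (derivationAction (ad ℂ L x) ω) +
        derivationAction (ad ℂ L ⁅y, x⁆) ω := by
  rw [derivationAction_comm]
  have h : ad ℂ L y * ad ℂ L x - ad ℂ L x * ad ℂ L y = ad ℂ L ⁅y, x⁆ :=
    LinearMap.ext fun u : L => (lie_lie y x u).symm
  rw [h]

lemma derivationAction_ad_compLinearMap {g : L ≃ₗ[ℂ] L} (hg : g ∈ adjointGroup L) (y : L)
    (ω : L [⋀^ι]→ₗ[ℂ] ℂ) :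
    derivationAction (ad ℂ L y) (ω.compLinearMap (g : L →ₗ[ℂ] L)) =
      (derivationAction (ad ℂ L (g y)) ω).compLinearMap (g : L →ₗ[ℂ] L) := by
  ext u
  simp only [derivationAction_apply, AlternatingMap.compLinearMap_apply]
  refine Finset.sum_congr rfl fun i _ => congrArg ω (funext fun j => ?_)
  rcases eq_or_ne j i with rfl | h
  · simp [adjointGroup_lie_apply hg]
  · simp [h]

/-- Let `Y` be a set of elements of `L` and `e` a family of vectors such that every form which is
annihilated, together with all its transforms under `Y`, by evaluation at `e` is annihilated
by evaluation at `e` after the action of any element of `L`. Then the forms of a `Y`-stable subspace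
annihilated by evaluation at `e` vanish on all translates of `e` by the adjoint group. -/
lemma apply_adjointGroup_eq_zero_of_mem (Y : Set L) (e : ι → L)
    (hY : ∀ N : Submodule ℂ (L [⋀^ι]→ₗ[ℂ] ℂ), (∀ ω ∈ N, ω e = 0) →
      (∀ y ∈ Y, ∀ ω ∈ N, derivationAction (ad ℂ L y) ω ∈ N) →
      ∀ x, ∀ ω ∈ N, derivationAction (ad ℂ L x) ω e = 0)
    {W : Submodule ℂ (L [⋀^ι]→ₗ[ℂ] ℂ)} (hWe : ∀ ω ∈ W, ω e = 0)
    (hWY : ∀ y ∈ Y, ∀ ω ∈ W, derivationAction (ad ℂ L y) ω ∈ W)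
    {g : L ≃ₗ[ℂ] L} (hg : g ∈ adjointGroup L) {ω : L [⋀^ι]→ₗ[ℂ] ℂ} (hω : ω ∈ W) :
    ω (fun i => g (e i)) = 0 := by
  let ev : (L [⋀^ι]→ₗ[ℂ] ℂ) →ₗ[ℂ] ℂ :=
    { toFun := fun ω => ω e, map_add' := fun _ _ => rfl, map_smul' := fun _ _ => rfl }
  let P : Set (Submodule ℂ (L [⋀^ι]→ₗ[ℂ] ℂ)) := {N | N ≤ LinearMap.ker ev ∧
    ∀ y ∈ Y, N ≤ N.comap (derivationAction (ad ℂ L y))}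
  -- The largest `Y`-stable space of forms vanishing at `e`; maximality will make it stable under
  -- all of `L` and under the adjoint group.
  set N := sSup P with hN
  have hNe : ∀ ω ∈ N, ω e = 0 := fun ω hω =>
    (sSup_le fun M (hM : M ∈ P) => hM.1 : N ≤ LinearMap.ker ev) hω
  have hNY : ∀ y ∈ Y, ∀ ω ∈ N, derivationAction (ad ℂ L y) ω ∈ N := fun y hy ω hω =>
    (sSup_le fun M (hM : M ∈ P) => (hM.2 y hy).trans
      (Submodule.comap_mono (le_sSup hM)) : N ≤ N.comap (derivationAction (ad ℂ L y))) hω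
  have hNL : ∀ x, ∀ ω ∈ N, derivationAction (ad ℂ L x) ω ∈ N := by
    intro x ω hω
    -- The transforms of N under `L` vanish at `e` by `hY`, and commuting y past x keeps their span
    -- `Y`-stable; so this span lies in N.
    let S : Set (L [⋀^ι]→ₗ[ℂ] ℂ) := {ω' | ∃ x, ∃ ω ∈ N, derivationAction (ad ℂ L x) ω = ω'}
    have hS : Submodule.span ℂ S ∈ P := by
      refine ⟨Submodule.span_le.2 ?_, fun y hy => Submodule.span_le.2 ?_⟩
      · rintro _ ⟨x, ω, hω, rfl⟩
        exact hY N hNe hNY x ω hω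
      · rintro _ ⟨x, ω, hω, rfl⟩
        change derivationAction (ad ℂ L y) (derivationAction (ad ℂ L x) ω) ∈ Submodule.span ℂ S
        rw [derivationAction_ad_comm]
        exact add_mem (Submodule.subset_span ⟨x, _, hNY y hy ω hω, rfl⟩)
          (Submodule.subset_span ⟨_, ω, hω, rfl⟩)
    exact le_sSup hS (Submodule.subset_span ⟨x, ω, hω, rfl⟩)
  have hexp : ∀ (z : L) (g : L ≃ₗ[ℂ] L), IsExp (ad ℂ L z) g →
      ∀ ω ∈ N, ω.compLinearMap (g : L →ₗ[ℂ] L) ∈ N := by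
    intro z g hg ω hω
    let pullback : (L [⋀^ι]→ₗ[ℂ] ℂ) →ₗ[ℂ] (L [⋀^ι]→ₗ[ℂ] ℂ) :=
      { toFun := fun ω => ω.compLinearMap (g : L →ₗ[ℂ] L)
        map_add' := fun _ _ => rfl
        map_smul' := fun _ _ => rfl }
    -- The pullback vanishes at `e` by the exponential series on N, and y acts on it as g y acts on
    -- N.
    have hM : Submodule.map pullback N ∈ P := by
      refine ⟨?_, fun y hy => ?_⟩
      · rintro _ ⟨ω, hω, rfl⟩
        exact apply_comp_exp_eq_zero hg N (fun ω hω => hNL z ω hω) hNe hω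
      · rintro _ ⟨ω, hω, rfl⟩
        exact ⟨_, hNL (g y) ω hω, (derivationAction_ad_compLinearMap hg.mem_adjointGroup y ω).symm⟩
    exact le_sSup hM ⟨ω, hω, rfl⟩
  have hgrp : ∀ ω ∈ N, ω.compLinearMap (g : L →ₗ[ℂ] L) ∈ N := by
    suffices h : (∀ ω ∈ N, ω.compLinearMap (g : L →ₗ[ℂ] L) ∈ N) ∧
        (∀ ω ∈ N, ω.compLinearMap ((g⁻¹ : L ≃ₗ[ℂ] L) : L →ₗ[ℂ] L) ∈ N) from h.1
    induction hg using Subgroup.closure_induction with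
    | mem g hg =>
      obtain ⟨z, hz⟩ := hg
      refine ⟨hexp z g hz, hexp (-z) g⁻¹ ?_⟩
      rw [map_neg]
      exact IsExp.symm hz
    | one => exact ⟨fun ω hω => hω, fun ω hω => hω⟩
    | mul g h _ _ ihg ihh =>
      refine ⟨fun ω hω => ihh.1 _ (ihg.1 ω hω), fun ω hω => ?_⟩
      rw [mul_inv_rev]
      exact ihg.2 _ (ihh.2 ω hω)
    | inv g _ ih => exact ⟨ih.2, by rw [inv_inv]; exact ih.1⟩
  have hWN : W ≤ N := le_sSup ⟨fun ω hω => hWe ω hω, fun y hy ω hω => hWY y hy ω hω⟩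
  exact hNe _ (hgrp ω (hWN hω))

variable {𝔥 : LieSubalgebra ℂ L} [𝔥.IsCartanSubalgebra]

/-- Let `a` and `b` be the sums of α(H₀) and α(H₁) over the roots α at level above c. If τ(a) >
τ(b), all forms of H₁-weight above τ(b) vanish on the translates of `e`. But the form dual to `e`
has H₀-weight `a`, so its transport by `g` has H₁-weight `a`, and it takes the value 1 at the
translate g e. -/
lemma sum_root_le_of_adjointGroup_apply_eq {τ : ℂ →ₗ[ℝ] ℝ} {H₀ H₁ : 𝔥}
    (hcompat : ∀ α ∈ 𝔥.root, 0 ≤ τ (α H₀) * τ (α H₁)) {g : L ≃ₗ[ℂ] L} (hg : g ∈ adjointGroup L)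
    (hgH : g H₀ = H₁) {c : ℝ} (hc : 0 ≤ c) :
    0 ≤ ∑ α : 𝔥.root with c < τ (α.1 H₀), (τ (α.1 H₁) - τ (α.1 H₀)) := by
  classical
  let ι := {α : 𝔥.root // c < τ (α.1 H₀)}
  choose e he f hf hfe using fun α : ι => exists_dual_rootVectors α.1
  have he0 (α) : e α ≠ 0 := fun h => by simpa [h] using hfe α
  set a := ∑ α : ι, α.1.1 H₀ with ha
  set b := ∑ α : ι, α.1.1 H₁ with hb
  suffices h : τ a ≤ τ b by
    rw [Finset.sum_sub_distrib, sub_nonneg]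
    rw [ha, hb, map_sum, map_sum] at h
    rwa [Finset.sum_subtype (p := fun α : 𝔥.root => c < τ (α.1 H₀)) _ (by simp),
      Finset.sum_subtype (p := fun α : 𝔥.root => c < τ (α.1 H₀)) _ (by simp)]
  by_contra! hlt
  -- `Y` contains 𝔥 and the root vectors with τ(α(H₁)) ≤ 0. For the other roots `hcompat` gives
  -- τ(α(H₀)) ≥ 0, so their vectors kill `e`. Acting by `Y` subtracts a weight with τ ≤ 0, hence
  -- preserves the span of `S`.
  let Y : Set L := {y | ∃ b : ℂ, τ b ≤ 0 ∧ ⁅(H₁ : L), y⁆ = b • y}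
  let S : Set (L [⋀^ι]→ₗ[ℂ] ℂ) :=
    {ω | ∃ a : ℂ, τ b < τ a ∧ derivationAction (ad ℂ L (H₁ : L)) ω = a • ω}
  have hY : ∀ N : Submodule ℂ (L [⋀^ι]→ₗ[ℂ] ℂ), (∀ ω ∈ N, ω e = 0) →
      (∀ y ∈ Y, ∀ ω ∈ N, derivationAction (ad ℂ L y) ω ∈ N) →
      ∀ x, ∀ ω ∈ N, derivationAction (ad ℂ L x) ω e = 0 := by
    intro N hNe hNY x
    induction x using rootSpace_induction 𝔥 with
    | hcartan h =>
      exact fun ω hω => hNe _ (hNY _ ⟨0, by simp, by simp [cartan_lie_eq_zero H₁.2 h.2]⟩ ω hω)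
    | hroot α hα x hx =>
      by_cases h1 : τ (α H₁) ≤ 0
      · exact fun ω hω => hNe _ (hNY _ ⟨α H₁, h1, cartan_lie_eq_smul hx H₁⟩ ω hω)
      · exact fun ω _ => derivationAction_ad_rootVector_eq_zero hc he he0 hα
          (nonneg_of_mul_nonneg_left (hcompat α hα) (not_le.1 h1)) hx ω
    | hadd x y hx hy =>
      intro ω hω
      rw [map_add, derivationAction_add, AlternatingMap.add_apply, hx ω hω, hy ω hω, add_zero]
  have hSe : ∀ ω ∈ Submodule.span ℂ S, ω e = 0 := by
    intro ω hω
    induction hω using Submodule.span_induction with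
    | mem ω hω =>
      obtain ⟨a, ha, hω⟩ := hω
      -- The wedge of `e` has H₁-eigenvalue `b`, so a form with another eigenvalue vanishes there.
      have h1 : derivationAction (ad ℂ L (H₁ : L)) ω e = b * ω e := by
        rw [derivationAction_apply, hb, Finset.sum_mul]
        refine Finset.sum_congr rfl fun α _ => ?_
        rw [ad_apply, cartan_lie_eq_smul (he α), ω.map_update_smul, Function.update_eq_self,
          smul_eq_mul]
      rw [hω, AlternatingMap.smul_apply, smul_eq_mul] at h1
      by_contra h0
      rw [mul_right_cancel₀ h0 h1] at ha
      exact lt_irrefl _ ha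
    | zero => rfl
    | add ω ω' _ _ h h' => rw [AlternatingMap.add_apply, h, h', add_zero]
    | smul c ω _ h => rw [AlternatingMap.smul_apply, h, smul_zero]
  have hSY : ∀ y ∈ Y, ∀ ω ∈ Submodule.span ℂ S,
      derivationAction (ad ℂ L y) ω ∈ Submodule.span ℂ S := by
    rintro y ⟨d, hd, hy⟩ ω hω
    refine (Submodule.span_le.2 ?_ : Submodule.span ℂ S ≤
      (Submodule.span ℂ S).comap (derivationAction (ad ℂ L y))) hω
    rintro ω ⟨a, ha, hω⟩
    refine Submodule.subset_span ⟨a - d, ?_, ?_⟩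
    · rw [map_sub]; linarith
    · rw [derivationAction_ad_comm, hω, ← lie_skew, hy, map_smul, ← neg_smul, map_smul,
        derivationAction_smul, ← add_smul, sub_eq_add_neg]
  let ω₀ : L [⋀^ι]→ₗ[ℂ] ℂ := (Matrix.detRowAlternating (R := ℂ) (n := ι)).compLinearMap
    (LinearMap.pi fun α => killingForm ℂ L (f α))
  have hω₀ : derivationAction (ad ℂ L (H₀ : L)) ω₀ = a • ω₀ := by
    refine derivationAction_det _ _ (fun α : ι => α.1.1 H₀) fun α u => ?_
    rw [ad_apply, killingForm_lie_right, cartan_lie_eq_smul (hf α)]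
    simp
  have hω₀e : ω₀ e = 1 := by
    change Matrix.det (Matrix.of fun α β => killingForm ℂ L (f β) (e α)) = 1
    rw [← Matrix.det_one (n := ι)]
    congr 1
    ext α β
    rcases eq_or_ne α β with rfl | h
    · simp [hfe]
    · rw [Matrix.one_apply_ne h, Matrix.of_apply]
      exact killingForm_eq_zero_of_mem_rootSpace (fun h' => h (Subtype.ext h'.symm)) (he α) (hf β)
  have hmem : ω₀.compLinearMap ((g⁻¹ : L ≃ₗ[ℂ] L) : L →ₗ[ℂ] L) ∈ Submodule.span ℂ S := by
    refine Submodule.subset_span ⟨a, hlt, ?_⟩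
    have hgH' : g⁻¹ (H₁ : L) = H₀ := by rw [← hgH]; exact g.symm_apply_apply _
    rw [derivationAction_ad_compLinearMap (inv_mem hg), hgH', hω₀]
    rfl
  have h0 := apply_adjointGroup_eq_zero_of_mem Y e hY hSe hSY hg hmem
  have h1 : ω₀.compLinearMap ((g⁻¹ : L ≃ₗ[ℂ] L) : L →ₗ[ℂ] L) (fun α => g (e α)) = ω₀ e :=
    congrArg ω₀ (funext fun α => g.symm_apply_apply (e α))
  rw [h1, hω₀e] at h0
  exact one_ne_zero h0

end HighestWeight

/-! ### Chambers and conjugacy within the Cartan subalgebra -/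

section WeylSeparation

open LieModule

variable {L : Type*} [LieRing L] [LieAlgebra ℂ L] [FiniteDimensional ℂ L]
  [IsSemisimple ℂ L] {𝔥 : LieSubalgebra ℂ L} [𝔥.IsCartanSubalgebra]

lemma root_ext {x y : 𝔥} (h : ∀ α : 𝔥.root, α.1 x = α.1 y) : x = y := by
  rw [← sub_eq_zero, ← Module.forall_dual_apply_eq_zero_iff ℂ]
  intro φ
  have hφ : φ ∈ Submodule.span ℂ (Weight.toLinear ℂ 𝔥 L '' {α | α.IsNonZero}) := by
    rw [IsKilling.span_weight_isNonZero_eq_top ℂ L 𝔥]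
    trivial
  induction hφ using Submodule.span_induction with
  | mem φ hφ =>
    obtain ⟨α, hα, rfl⟩ := hφ
    rw [map_sub, sub_eq_zero]
    exact h ⟨α, by simpa using hα⟩
  | zero => rfl
  | add φ ψ _ _ h h' => rw [LinearMap.add_apply, h, h', add_zero]
  | smul c φ _ h => rw [LinearMap.smul_apply, h, smul_zero]

lemma root_sub_smul_coroot (α β : 𝔥.root) (y : 𝔥) :
    β.1 (y - α.1 y • IsKilling.coroot α.1) = β.1 y - α.1 y * β.1 (IsKilling.coroot α.1) := by
  have h : Weight.toLinear ℂ 𝔥 L β.1 (y - α.1 y • IsKilling.coroot α.1) =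
      Weight.toLinear ℂ 𝔥 L β.1 y -
        α.1 y * Weight.toLinear ℂ 𝔥 L β.1 (IsKilling.coroot α.1) := by
    rw [map_sub, map_smul, smul_eq_mul]
  exact h

/-- Reflections permute the roots, so on the orbit all root values are root values of `H`; and roots
separate points of 𝔥. -/
lemma weylOrbit_finite (H : 𝔥) : (weylOrbit H).Finite := by
  have hroot : ∀ y ∈ weylOrbit H, ∀ α : 𝔥.root, ∃ β : 𝔥.root, α.1 y = β.1 H := by
    intro y hy
    refine weylOrbit_induction (p := fun y => ∀ α : 𝔥.root, ∃ β : 𝔥.root, α.1 y = β.1 H)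
      (fun α => ⟨α, rfl⟩) (fun y hy γ α => ?_) hy
    obtain ⟨β, hβ⟩ := hy ((IsKilling.rootSystem 𝔥).reflectionPerm γ α)
    refine ⟨β, hβ ▸ ?_⟩
    have h := (IsKilling.rootSystem 𝔥).root_reflectionPerm γ α
    rw [RootPairing.reflection_apply_root] at h
    have h1 := congr($h y)
    rw [root_sub_smul_coroot]
    refine Eq.trans ?_ h1.symm
    change _ = α.1 y - α.1 (IsKilling.coroot γ.1) * γ.1 y
    ring
  have hinj : Set.InjOn (fun (y : 𝔥) (α : 𝔥.root) => α.1 y) (weylOrbit H) :=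
    fun x _ y _ h => root_ext fun α => congrFun h α
  refine Set.Finite.of_finite_image (Set.Finite.subset (Set.Finite.pi' (t := fun _ =>
    Set.range fun β : 𝔥.root => β.1 H) fun _ => Set.finite_range _) ?_) hinj
  rintro _ ⟨y, hy, rfl⟩ α
  obtain ⟨β, hβ⟩ := hroot y hy α
  exact ⟨β, hβ.symm⟩

/-- On 𝔥 the Killing form is ∑ β ⊗ β and the coroot is dual to a multiple of α. Evaluating at the
coroot, where α is 2, gives r = ½ ∑ n(β)² > 0. -/
lemma exists_sum_root_coroot_mul (α : 𝔥.root) :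
    ∃ (n : 𝔥.root → ℝ) (r : ℝ), 0 < r ∧ (∀ β, β.1 (IsKilling.coroot α.1) = n β) ∧
      ∀ y : 𝔥, ∑ β : 𝔥.root, (n β : ℂ) * β.1 y = r * α.1 y := by
  have hα := 𝔥.isNonZero_coe_root α
  obtain ⟨n, hn⟩ : ∃ n : 𝔥.root → ℝ, ∀ β, β.1 (IsKilling.coroot α.1) = n β :=
    ⟨fun β => ((chainBotCoeff α.1 β.1 - chainTopCoeff α.1 β.1 : ℤ) : ℝ), fun β => by
      rw [IsKilling.apply_coroot_eq_cast]; push_cast; rfl⟩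
  obtain ⟨c, hc⟩ : ∃ c : ℂ, ∀ y : 𝔥, ∑ β : 𝔥.root, (n β : ℂ) * β.1 y = c * α.1 y := by
    refine ⟨2 * (α.1 ((IsKilling.cartanEquivDual 𝔥).symm α.1.toLinear))⁻¹, fun y => ?_⟩
    have h1 := IsKilling.traceForm_coroot α.1 y
    have h2 := congr($(IsKilling.restrict_killingForm_eq_sum (K := ℂ) (L := L) (H := 𝔥))
      (IsKilling.coroot α.1) y)
    have h3 : traceForm ℂ 𝔥 L (IsKilling.coroot α.1) y =
      (killingForm ℂ L).restrict 𝔥.toSubmodule (IsKilling.coroot α.1) y := rfl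
    rw [h3, h2] at h1
    rw [nsmul_eq_mul, Nat.cast_ofNat, smul_eq_mul, ← mul_assoc] at h1
    rw [← h1]
    simp only [LinearMap.sum_apply, ← hn]
    exact Finset.sum_coe_sort 𝔥.root fun β : Weight ℂ 𝔥 L => β (IsKilling.coroot α.1) * β y
  have h1 := hc (IsKilling.coroot α.1)
  rw [IsKilling.root_apply_coroot hα] at h1
  simp only [hn] at h1
  have hc' : c = ((∑ β, n β * n β) / 2 : ℝ) := by
    push_cast
    rw [h1]
    ring
  refine ⟨n, _, ?_, hn, fun y => hc' ▸ hc y⟩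
  have hnα : n α = 2 := by
    have := (hn α).symm.trans (IsKilling.root_apply_coroot hα)
    exact_mod_cast this
  have : 0 < ∑ β, n β * n β := Finset.sum_pos' (fun β _ => mul_self_nonneg _)
    ⟨α, Finset.mem_univ _, by rw [hnα]; norm_num⟩
  positivity

/-- In each Weyl orbit there is an element lying in a common closed chamber with `x`. -/
lemma exists_mem_weylOrbit_forall_root_mul_nonneg (τ : ℂ →ₗ[ℝ] ℝ) (x H : 𝔥) :
    ∃ y ∈ weylOrbit H, ∀ α ∈ 𝔥.root, 0 ≤ τ (α x) * τ (α y) := by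
  -- Maximize the pairing with x over the finite orbit: reflecting y in α changes it by -r τ(α x)
  -- τ(α y), which cannot be positive.
  obtain ⟨y, hy, hmax⟩ := Set.exists_max_image (weylOrbit H)
    (fun y => ∑ β : 𝔥.root, τ (β.1 x) * τ (β.1 y)) (weylOrbit_finite H) ⟨H, self_mem_weylOrbit H⟩
  refine ⟨y, hy, fun α hα => ?_⟩
  obtain ⟨n, r, hr, hn, hsum⟩ := exists_sum_root_coroot_mul ⟨α, hα⟩
  have h1 := hmax _ (sub_smul_coroot_mem_weylOrbit hy ⟨α, hα⟩)
  have hτ (s : ℝ) (z : ℂ) : τ (s * z) = s * τ z := by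
    rw [← Complex.real_smul, map_smul, smul_eq_mul]
  have h2 (β : 𝔥.root) : τ (β.1 x) * τ (β.1 (y - α y • IsKilling.coroot α)) =
      τ (β.1 x) * τ (β.1 y) - τ (α y) * τ (n β * β.1 x) := by
    rw [root_sub_smul_coroot ⟨α, hα⟩ β y, hn β, map_sub, mul_comm (α y), hτ, hτ]
    ring
  simp only [h2, Finset.sum_sub_distrib, ← Finset.mul_sum, ← map_sum] at h1
  rw [hsum, hτ] at h1
  have h3 : 0 ≤ r * (τ (α x) * τ (α y)) := by
    have : r * (τ (α x) * τ (α y)) = τ (α y) * (r * τ (α x)) := by ring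
    linarith
  exact nonneg_of_mul_nonneg_right h3 hr

variable [TopologicalSpace L] [IsTopologicalAddGroup L] [ContinuousSMul ℂ L] [T2Space L]

/-- The level inequality for τ treats the roots with τ(α(H₀)) > 0, and that for -τ those with
τ(α(H₀)) < 0. -/
lemma sum_root_mul_sub_nonneg {τ : ℂ →ₗ[ℝ] ℝ} {H₀ H₁ : 𝔥}
    (hcompat : ∀ α ∈ 𝔥.root, 0 ≤ τ (α H₀) * τ (α H₁)) {g : L ≃ₗ[ℂ] L} (hg : g ∈ adjointGroup L)
    (hgH : g H₀ = H₁) :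
    0 ≤ ∑ α : 𝔥.root, τ (α.1 H₀) * (τ (α.1 H₁) - τ (α.1 H₀)) := by
  have key (τ : ℂ →ₗ[ℝ] ℝ) (hcompat : ∀ α ∈ 𝔥.root, 0 ≤ τ (α H₀) * τ (α H₁)) :
      0 ≤ ∑ α : 𝔥.root with 0 < τ (α.1 H₀), τ (α.1 H₀) * (τ (α.1 H₁) - τ (α.1 H₀)) := by
    refine sum_mul_nonneg_of_forall_sum_filter_nonneg _ _ _
      (fun α hα => (Finset.mem_filter.1 hα).2) fun c hc => ?_
    have h := sum_root_le_of_adjointGroup_apply_eq hcompat hg hgH hc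
    rw [Finset.filter_filter]
    convert h using 2
    ext α
    simp only [Finset.mem_filter, Finset.mem_univ, true_and, and_iff_right_iff_imp]
    exact fun h => hc.trans_lt h
  have h1 := key τ hcompat
  have h2 := key (-τ) (by simpa using hcompat)
  rw [Finset.sum_filter] at h1 h2
  have h3 := add_nonneg h1 h2
  rw [← Finset.sum_add_distrib] at h3
  refine h3.trans_eq (Finset.sum_congr rfl fun α _ => ?_)
  simp only [LinearMap.neg_apply, Left.neg_pos_iff]
  rcases lt_trichotomy (τ (α.1 H₀)) 0 with h | h | h
  · rw [if_neg h.not_gt, if_pos h]; ring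
  · simp [h]
  · rw [if_pos h, if_neg h.not_gt]; ring

/-- Adding the previous inequality to the one with H₀ and H₁ exchanged leaves minus a sum of
squares. -/
lemma root_apply_eq_of_adjointGroup_apply_eq {τ : ℂ →ₗ[ℝ] ℝ} {H₀ H₁ : 𝔥}
    (hcompat : ∀ α ∈ 𝔥.root, 0 ≤ τ (α H₀) * τ (α H₁)) {g : L ≃ₗ[ℂ] L} (hg : g ∈ adjointGroup L)
    (hgH : g H₀ = H₁) (α : 𝔥.root) : τ (α.1 H₀ - α.1 H₁) = 0 := by
  have h1 := sum_root_mul_sub_nonneg hcompat hg hgH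
  have h2 := sum_root_mul_sub_nonneg (fun α hα => by rw [mul_comm]; exact hcompat α hα)
    (inv_mem hg) (show g⁻¹ (H₁ : L) = H₀ by rw [← hgH]; exact g.symm_apply_apply _)
  have h3 : ∑ α : 𝔥.root, (τ (α.1 H₀ - α.1 H₁)) ^ 2 ≤ 0 := by
    have h4 := add_nonneg h1 h2
    rw [← Finset.sum_add_distrib] at h4
    rw [← neg_nonneg, ← Finset.sum_neg_distrib]
    refine h4.trans_eq (Finset.sum_congr rfl fun α _ => ?_)
    rw [map_sub]
    ring
  have h4 := (Finset.sum_eq_zero_iff_of_nonneg fun α _ => sq_nonneg _).1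
    (le_antisymm h3 (Finset.sum_nonneg fun α _ => sq_nonneg _)) α (Finset.mem_univ α)
  exact pow_eq_zero_iff two_ne_zero |>.1 h4

lemma mem_weylOrbit_of_mem_adjointOrbit {H₀ H₁ : 𝔥} (h : (H₁ : L) ∈ adjointOrbit (H₀ : L)) :
    H₁ ∈ weylOrbit H₀ := by
  -- τ must be chosen before y, so it separates α(H₀) from α(z) for every z in the orbit of H₁.
  obtain ⟨τ, hτ⟩ := exists_real_linear_form_injOn (((weylOrbit_finite H₁).prod
    (Set.finite_univ (α := 𝔥.root))).image fun p => p.2.1 H₀ - p.2.1 p.1)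
  obtain ⟨y, hy, hcompat⟩ := exists_mem_weylOrbit_forall_root_mul_nonneg τ H₀ H₁
  have hyO : (y : L) ∈ adjointOrbit (H₀ : L) := by
    have h1 : adjointOrbit (H₁ : L) = adjointOrbit (H₀ : L) := MulAction.orbit_eq_iff.2 h
    exact h1 ▸ mem_adjointOrbit_of_mem_weylOrbit hy
  obtain ⟨g, hg, hgy⟩ := mem_adjointOrbit_iff.1 hyO
  have hH₀ : H₀ = y := root_ext fun α => sub_eq_zero.1 <|
    hτ _ ⟨(y, α), ⟨hy, trivial⟩, rfl⟩ (root_apply_eq_of_adjointGroup_apply_eq hcompat hg hgy α)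
  exact MulAction.mem_orbit_symm.1 (hH₀ ▸ hy)

end WeylSeparation

end

theorem mainTheorem2 {L : Type*} [LieRing L] [LieAlgebra ℂ L] [FiniteDimensional ℂ L]
    [LieAlgebra.IsSemisimple ℂ L]
    [TopologicalSpace L] [IsTopologicalAddGroup L] [ContinuousSMul ℂ L] [T2Space L]
    (𝔥 : LieSubalgebra ℂ L) [𝔥.IsCartanSubalgebra]
    (H₀ H : 𝔥) (hH : H ∈ realCartan 𝔥) (hreg : IsRegularElement H) :
    IsComplexSubmanifold (adjointOrbit (H₀ : L)) ∧
    (∀ x : adjointOrbit (H₀ : L),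
      IsCriticalPoint (heightFunction (H : L) (H₀ : L)) x ↔
        (x : L) ∈ adjointOrbit (H₀ : L) ∩ (𝔥 : Set L)) ∧
    adjointOrbit (H₀ : L) ∩ (𝔥 : Set L) = (fun y : 𝔥 => (y : L)) '' weylOrbit H₀ := by
  refine ⟨isComplexSubmanifold_adjointOrbit H₀, fun x => ?_, Set.Subset.antisymm ?_ ?_⟩
  · rw [isCriticalPoint_heightFunction_iff, hreg.lie_eq_zero_iff]
    exact (and_iff_right x.2).symm
  · rintro x ⟨hxO, hx⟩
    exact ⟨⟨x, hx⟩, mem_weylOrbit_of_mem_adjointOrbit hxO, rfl⟩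
  · rintro _ ⟨y, hy, rfl⟩
    exact ⟨mem_adjointOrbit_of_mem_weylOrbit hy, y.2⟩
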